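/- Fix $\beta\in(0,\infty)$. For $n\ge 1$ and $1\le i\le n$ put $q_i=\dfrac{e^{-\beta i/n}}{1+e^{-\beta i/n}}$. The linear reliability channel (LRC) with parameter $\beta$ takes an input word $X^n\in\{0,1\}^n$ (with an arbitrary distribution), draws a permutation $T$ of $\{1,\dots,n\}$ uniformly at random and independently of $X^n$, and outputs $Y^n\in\{0,1\}^n$ where, given $X^n$ and $T$, the bits of $Y^n$ are independent and $Y^n_i$ differs from $X^n_i$ with probability $q_{T(i)}$. The hard-decision noise effect is $Z^n=X^n+Y^n$ (coordinatewise addition mod 2), with its unconditional distribution ($T$ is averaged out). Let $G_{\mathrm H}:\{0,1\}^n\to\{1,\dots,2^n\}$ be any bijection that orders words by nondecreasing Hamming weight $w_{\mathrm H}$, i.e. $G_{\mathrm H}(x_1)<G_{\mathrm H}(x_2)$ implies $w_{\mathrm H}(x_1)\le w_{\mathrm H}(x_2)$, and $w_{\mathrm H}(x_1)<w_{\mathrm H}(x_2)$ implies $G_{\mathrm H}(x_1)<G_{\mathrm H}(x_2)$. For $\rho\in(0,1)\cup(1,\infty)$ let $$H_\rho(Z)=\lim_{n\to\infty}\frac1n\cdot\frac{1}{1-\rho}\ln\sum_{x\in\{0,1\}^n}\Pr\{Z^n=x\}^\rho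 ,$$ and let $H_1(Z)=\lim_{\rho\to1}H_\rho(Z)$ and $H_{\min}(Z)=\lim_{\rho\to\infty}H_\rho(Z)$. Let $h(t)=-t\ln t-(1-t)\ln(1-t)$ be the binary entropy function on $[0,1]$ and $J(r;\gamma)=\int_0^1\ln(1+re^{-\gamma x})\,dx$ for $r\ge0$, $\gamma>0$. **Theorem.** All the limits above exist and are finite. For every $\alpha\in\mathbb R$ the scaled cumulant generating function $\Lambda_Z(\alpha)=\lim_{n\to\infty}\frac1n\ln\mathbb E\left[e^{\alpha\ln G_{\mathrm H}(Z^n)}\right]$ of the hard-decision guesswork process $\{n^{-1}\ln G_{\mathrm H}(Z^n)\}$ exists and $$\Lambda_Z(\alpha)=\begin{cases}\alpha H_{\frac1{1+\alpha}}(Z), & \alpha>-1,\\ -H_{\min}(Z), & \alpha\le-1.\end{cases}$$ Moreover, for every $\alpha>-1$, $$\alpha H_{\frac1{1+\alpha}}(Z)=\max_{t\in[0,1]}\Big\{\alpha h(t)+J(r_{t,\beta};\beta)-t\ln r_{t,\beta}\Big\}-J(1;\beta),\qquad r_{t,\beta}=\frac{e^{\beta t}-1}{1-e^{\beta(t-1)}},$$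 where $J(r_{t,\beta};\beta)-t\ln r_{t,\beta}$ is understood at the endpoints $t=0$ and $t=1$ as its limit, that is, as $0$ and $-\beta/2$ respectively; and $$H_{\min}(Z)=J(1;\beta).$$ -/

import Mathlib

open Filter Topology

namespace LRC

noncomputable section

/-- Binary words of length `n`, with coordinatewise addition modulo 2. -/
abbrev Word (n : ℕ) : Type := Fin n → ZMod 2

/-! ### The linear reliability channel -/

/-- The bit-flip probability `e^{-β i/n} / (1 + e^{-β i/n})` of reliability rank `i ∈ {1, …, n}`.
The rank `i` is represented by the element `i - 1` of `Fin n`. -/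
def flipProb (β : ℝ) (n : ℕ) (i : Fin n) : ℝ :=
  Real.exp (-β * ((i : ℕ) + 1 : ℝ) / n) / (1 + Real.exp (-β * ((i : ℕ) + 1 : ℝ) / n))

/-- The probability of receiving the bit `y` when the bit `x` is sent through the binary
symmetric channel with bit-flip probability `q`. -/
def bitProb (q : ℝ) (x y : ZMod 2) : ℝ := if y = x then 1 - q else q

theorem flipProb_nonneg (β : ℝ) (n : ℕ) (i : Fin n) : 0 ≤ flipProb β n i := by
  unfold flipProb
  positivity

theorem flipProb_le_one (β : ℝ) (n : ℕ) (i : Fin n) : flipProb β n i ≤ 1 := by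
  unfold flipProb
  rw [div_le_one (by positivity)]
  linarith

theorem bitProb_nonneg {q : ℝ} (h0 : 0 ≤ q) (h1 : q ≤ 1) (x y : ZMod 2) : 0 ≤ bitProb q x y := by
  unfold bitProb
  split_ifs <;> linarith

theorem sum_bitProb (q : ℝ) (x : ZMod 2) : ∑ y, bitProb q x y = 1 := by
  have h : (Finset.univ : Finset (ZMod 2)) = {0, 1} := by decide
  have h10 : (1 : ZMod 2) ≠ 0 := by decide
  rw [h, Finset.sum_pair h10.symm]
  unfold bitProb
  have hx : x = 0 ∨ x = 1 := by revert x; decide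
  rcases hx with rfl | rfl
  · simp
  · simp

/-- The law of the output word when the input word is `x` and the reliability ordering
permutation is `τ`: given `τ`, the bits are received independently, and bit `i` is flipped with
probability `flipProb β n (τ i)`. -/
def channel (β : ℝ) (n : ℕ) (τ : Equiv.Perm (Fin n)) (x : Word n) : PMF (Word n) :=
  PMF.ofFintype
    (fun y => ENNReal.ofReal (∏ i, bitProb (flipProb β n (τ i)) (x i) (y i)))
    (by
      rw [← ENNReal.ofReal_sum_of_nonneg fun y _ => Finset.prod_nonneg fun i _ =>
        bitProb_nonneg (flipProb_nonneg _ _ _) (flipProb_le_one _ _ _) _ _,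
        ← Fintype.prod_sum fun (i : Fin n) (b : ZMod 2) =>
          bitProb (flipProb β n (τ i)) (x i) b]
      simp [sum_bitProb])

/-- The joint law of the input `X`, the reliability ordering permutation `T` and the output `Y`
in one use of the channel: `X` has law `inp`, and `T` is uniform and independent of `X`. -/
def jointLaw (β : ℝ) (n : ℕ) (inp : PMF (Word n)) :
    PMF (Word n × Equiv.Perm (Fin n) × Word n) :=
  inp.bind fun x =>
    (PMF.uniformOfFintype (Equiv.Perm (Fin n))).bind fun τ =>
      (channel β n τ x).map fun y => (x, τ, y)

/-- The law of the hard-decision noise effect `Z = X + Y`, the permutation `T` being unknown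
(averaged out). -/
def hardNoise (β : ℝ) (n : ℕ) (inp : PMF (Word n)) : PMF (Word n) :=
  (jointLaw β n inp).map fun u => u.1 + u.2.2

/-! ### Guessing functions -/

/-- `G` is a hard-decision guessing function: an invertible map from the words of length `n` onto
`{1, …, 2 ^ n}` that lists the words in order of nondecreasing Hamming weight. -/
structure IsHardGuessing (n : ℕ) (G : Word n → ℕ) : Prop where
  bijOn : Set.BijOn G Set.univ (Set.Icc 1 (2 ^ n))
  weight_le : ∀ x₁ x₂ : Word n, G x₁ < G x₂ → hammingNorm x₁ ≤ hammingNorm x₂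
  lt_of_weight_lt : ∀ x₁ x₂ : Word n, hammingNorm x₁ < hammingNorm x₂ → G x₁ < G x₂

/-! ### Scaled cumulant generating functions and entropies (natural logarithms) -/

/-- The expectation of a real function of a random element with law `p` in a finite set. -/
def expect {S : Type*} [Fintype S] (p : PMF S) (f : S → ℝ) : ℝ :=
  ∑ s, (p s).toReal * f s

/-- `Λ` is the scaled cumulant generating function of the process `A n`, where `A n` is evaluated
at a random element with law `p n`: for every real `α`, the limit of
`(1 / n) ln E[exp (α n A n)]` exists and is `Λ α`. -/
def IsSCGF {S : ℕ → Type*} [∀ n, Fintype (S n)] (p : ∀ n, PMF (S n)) (A : ∀ n, S n → ℝ)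
    (Λ : ℝ → ℝ) : Prop :=
  ∀ α : ℝ, Tendsto
    (fun n : ℕ => 1 / (n : ℝ) * Real.log (expect (p n) fun s => Real.exp (α * n * A n s)))
    atTop (𝓝 (Λ α))

/-- The Rényi entropy of order `ρ`, for `ρ ∈ (0, 1) ∪ (1, ∞)`. -/
def renyiEntropy {S : Type*} [Fintype S] (ρ : ℝ) (p : PMF S) : ℝ :=
  1 / (1 - ρ) * Real.log (∑ s, (p s).toReal ^ ρ)

/-- `H ρ`, `ρ > 0`, are the Rényi entropy rates of a sequence of random elements with laws `p n`,
and `Hmin` is its min-entropy rate. The rate of order 1 (the Shannon entropy rate) is the limit of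
`H ρ` as `ρ → 1`, and the min-entropy rate is the limit of `H ρ` as `ρ → ∞`. -/
structure HasRenyiRates {S : ℕ → Type*} [∀ n, Fintype (S n)] (p : ∀ n, PMF (S n))
    (H : ℝ → ℝ) (Hmin : ℝ) : Prop where
  rate : ∀ ρ : ℝ, 0 < ρ → ρ ≠ 1 →
    Tendsto (fun n : ℕ => 1 / (n : ℝ) * renyiEntropy ρ (p n)) atTop (𝓝 (H ρ))
  shannon : Tendsto H (𝓝[≠] 1) (𝓝 (H 1))
  min : Tendsto H atTop (𝓝 Hmin)

/-! ### The functions in the formula -/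

/-- `J(r; γ) = ∫₀¹ ln (1 + r e^{-γ x}) dx`. -/
def J (r γ : ℝ) : ℝ := ∫ x in (0 : ℝ)..1, Real.log (1 + r * Real.exp (-γ * x))

/-- `r_{t,β} = (e^{β t} - 1) / (1 - e^{β (t - 1)})`, for `0 ≤ t < 1`. -/
def saddle (t β : ℝ) : ℝ := (Real.exp (β * t) - 1) / (1 - Real.exp (β * (t - 1)))

/-- `J(r_{t,β}; β) - t ln r_{t,β}` on `[0, 1]`. At `t = 1`, where `r_{t,β}` is infinite, the value
is the limit `-β / 2` as `t → 1`. At `t = 0`, where `r_{t,β} = 0`, the formula gives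
`0` (with `0 ln 0 = 0`), which is the limit as `t → 0`. -/
def growth (t β : ℝ) : ℝ :=
  if t = 1 then -β / 2 else J (saddle t β) β - t * Real.log (saddle t β)

end

end LRC

/-! Write x = e^{-β/n}. Rank i flips its bit with odds x^i, so averaging over the uniform
permutation gives a word of weight w the probability e_w(x, …, x^n) / (C(n,w) ∏(1 + x^i)), whatever
the input law (`hardNoise_toReal_eq`). This is nonincreasing in w, hence guessing by Hamming weight
is guessing in order of probability. Arikan's inequalities then identify E[G^α], for α > -1, with (∑
p^{1/(1+α)})^{1+α} up to a factor harmonic(2^n)^{±|α|}, which is only polynomial in n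
(`abs_log_guess_moment_sub_le`).

It remains to find the exponent of the Rényi sums. Grouped by weight they have n + 1 terms, so the
largest exponent wins. The binomial coefficient contributes h(w/n). For e_w, the generating function
∏(1 + r x^i) = ∑ e_k r^k gives e_w r^w ≤ ∏(1 + r x^i) for every r ≥ 0. At the saddle point r the
exact ratio e_{k+1}/e_k shows that k = w is the largest term, so the bound loses at most a factor n
+ 1 (`prod_one_add_geom_le`). Comparing the logarithm of the product with n J(r; β) yields e_w ≈
exp(n growth(w/n)) uniformly in w (`log_geomEsymm_bounds`), and the variational formula follows
(`tendsto_log_renyiSum`).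

The limits in ρ are read off the maximum as a function of α = 1/ρ - 1. At α = 0 it is differentiable
because growth has a unique maximizer (`tendsto_maxExponent_slope`). At α = -1 it vanishes because
growth ≤ h with equality at t = 0. For α ≤ -1 the moment is governed by the most probable word alone
(`guessMoment_bounds_of_le`). -/

namespace LRC

/-! ### Elementary symmetric polynomials of a geometric progression -/

/-- The elementary symmetric polynomial of degree `k` in `x, x ^ 2, …, x ^ n`. -/
noncomputable def geomEsymm (x : ℝ) (n k : ℕ) : ℝ :=
  ∑ s ∈ Finset.powersetCard k (Finset.range n), ∏ i ∈ s, x ^ (i + 1)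

theorem geomEsymm_zero_right (x : ℝ) (n : ℕ) : geomEsymm x n 0 = 1 := by
  simp [geomEsymm]

theorem geomEsymm_zero_succ (x : ℝ) (k : ℕ) : geomEsymm x 0 (k + 1) = 0 := by
  rw [geomEsymm, Finset.powersetCard_eq_empty.2 (by simp), Finset.sum_empty]

theorem geomEsymm_succ_succ (x : ℝ) (n k : ℕ) :
    geomEsymm x (n + 1) (k + 1) = geomEsymm x n (k + 1) + x ^ (n + 1) * geomEsymm x n k := by
  unfold geomEsymm
  have hn : ∀ s ∈ Finset.powersetCard k (Finset.range n), n ∉ s := fun s hs h => by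
    have := (Finset.mem_powersetCard.1 hs).1 h
    simp at this
  rw [Finset.range_add_one, Finset.powersetCard_succ_insert (by simp), Finset.sum_union,
    Finset.sum_image, Finset.mul_sum]
  · congr 1
    exact Finset.sum_congr rfl fun s hs => Finset.prod_insert (hn s hs)
  · intro s hs t ht hst
    rw [← Finset.erase_insert (hn s hs), ← Finset.erase_insert (hn t ht), hst]
  · rw [Finset.disjoint_left]
    intro s hs hs'
    obtain ⟨t, -, rfl⟩ := Finset.mem_image.1 hs'
    have := (Finset.mem_powersetCard.1 hs).1 (Finset.mem_insert_self n t)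
    simp at this

/-- The quotient of consecutive q-binomial coefficients with q = x, kept free of division; the
Pascal-type recursion in n proves it. It makes unimodality of e_k r^k in k a matter of signs. -/
theorem geomEsymm_ratio (x : ℝ) (n : ℕ) : ∀ k : ℕ,
    (1 - x ^ (k + 1)) * geomEsymm x n (k + 1) = (x ^ (k + 1) - x ^ (n + 1)) * geomEsymm x n k := by
  induction n with
  | zero =>
    rintro (_ | k)
    · simp [geomEsymm_zero_succ]
    · simp [geomEsymm_zero_succ]
  | succ n ih =>
    rintro (_ | k)
    · have h := ih 0
      rw [geomEsymm_succ_succ]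
      simp only [geomEsymm_zero_right] at h ⊢
      linear_combination h
    · have h := ih (k + 1)
      have h' := ih k
      rw [geomEsymm_succ_succ, geomEsymm_succ_succ]
      linear_combination h + x ^ (n + 2) * h'

theorem geomEsymm_nonneg {x : ℝ} (hx : 0 ≤ x) (n k : ℕ) : 0 ≤ geomEsymm x n k :=
  Finset.sum_nonneg fun _ _ => Finset.prod_nonneg fun _ _ => by positivity

theorem geomEsymm_pos {x : ℝ} (hx : 0 < x) {n k : ℕ} (h : k ≤ n) : 0 < geomEsymm x n k :=
  Finset.sum_pos (fun _ _ => Finset.prod_pos fun _ _ => by positivity)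
    (Finset.powersetCard_nonempty.2 (by simpa using h))

theorem geomEsymm_self (x : ℝ) (n : ℕ) : geomEsymm x n n = ∏ i ∈ Finset.range n, x ^ (i + 1) := by
  have : Finset.powersetCard n (Finset.range n) = {Finset.range n} := by
    simpa using Finset.powersetCard_self (Finset.range n)
  rw [geomEsymm, this, Finset.sum_singleton]

theorem prod_one_add_geom (x r : ℝ) (n : ℕ) :
    ∏ i ∈ Finset.range n, (1 + r * x ^ (i + 1))
      = ∑ k ∈ Finset.range (n + 1), geomEsymm x n k * r ^ k := by
  rw [Finset.prod_one_add, Finset.sum_powerset, Finset.card_range]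
  refine Finset.sum_congr rfl fun k _ => ?_
  rw [geomEsymm, Finset.sum_mul]
  refine Finset.sum_congr rfl fun s hs => ?_
  rw [Finset.prod_mul_distrib, Finset.prod_const, (Finset.mem_powersetCard.1 hs).2, mul_comm]

theorem le_of_unimodal {c : ℕ → ℝ} {w : ℕ} (h₁ : ∀ k < w, c k ≤ c (k + 1))
    (h₂ : ∀ k, w ≤ k → c (k + 1) ≤ c k) (k : ℕ) : c k ≤ c w := by
  rcases le_total k w with h | h
  · refine Nat.decreasingInduction' (P := fun k => c k ≤ c w) ?_ h le_rfl
    exact fun j hj _ ih => (h₁ j hj).trans ih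
  · induction k, h using Nat.le_induction with
    | base => exact le_rfl
    | succ k hk ih => exact (h₂ k hk).trans ih

theorem sum_le_of_unimodal {c : ℕ → ℝ} {w n : ℕ} (h₁ : ∀ k < w, c k ≤ c (k + 1))
    (h₂ : ∀ k, w ≤ k → c (k + 1) ≤ c k) :
    ∑ k ∈ Finset.range (n + 1), c k ≤ (n + 1) * c w := by
  refine (Finset.sum_le_card_nsmul _ _ (c w) fun k _ => le_of_unimodal h₁ h₂ k).trans ?_
  simp

/-- At the saddle point the term of index `w` is the largest one. -/
theorem prod_one_add_geom_le {x r : ℝ} (hx0 : 0 < x) (hx1 : x < 1) {n w : ℕ} (hw : w < n)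
    (hr : r * (x ^ w - x ^ n) = 1 - x ^ w) :
    ∏ i ∈ Finset.range n, (1 + r * x ^ (i + 1)) ≤ (n + 1) * (geomEsymm x n w * r ^ w) := by
  have hmono : ∀ {a b : ℕ}, a ≤ b → x ^ b ≤ x ^ a := fun h =>
    pow_le_pow_of_le_one hx0.le hx1.le h
  have hlt : x ^ n < x ^ w := pow_lt_pow_right_of_lt_one₀ hx0 hx1 hw
  have hr0 : 0 ≤ r := by
    by_contra! h
    have h1 : x ^ w ≤ 1 := pow_le_one₀ hx0.le hx1.le
    nlinarith
  rw [prod_one_add_geom]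
  have step : ∀ k, (1 - x ^ (k + 1)) * (geomEsymm x n (k + 1) * r ^ (k + 1))
      = r * (x ^ (k + 1) - x ^ (n + 1)) * (geomEsymm x n k * r ^ k) := fun k => by
    rw [pow_succ r k]
    linear_combination r ^ k * r * geomEsymm_ratio x n k
  have hpos : ∀ k, 0 < 1 - x ^ (k + 1) := fun k =>
    sub_pos.2 (pow_lt_one₀ hx0.le hx1 (Nat.succ_ne_zero k))
  have hnn : ∀ k, 0 ≤ geomEsymm x n k * r ^ k := fun k =>
    mul_nonneg (geomEsymm_nonneg hx0.le n k) (pow_nonneg hr0 k)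
  -- The sign of the bracket decides whether the terms increase at k. The positive factor x^w - x^n
  -- lets `hr` eliminate r. In `key'` both summands are nonnegative when k + 1 ≤ w; when k ≥ w the
  -- worst case k = w gives exactly -(1 - x)(x^w - x^n).
  have key : ∀ k, (x ^ w - x ^ n) * (r * (x ^ (k + 1) - x ^ (n + 1)) - (1 - x ^ (k + 1)))
      = (x ^ (k + 1) - x ^ w) + (x ^ w * x ^ (n + 1) - x ^ n * x ^ (k + 1))
        + (x ^ n - x ^ (n + 1)) := fun k => by
    linear_combination (x ^ (k + 1) - x ^ (n + 1)) * hr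
  have key' : ∀ k, (x ^ w - x ^ n) * (r * (x ^ (k + 1) - x ^ (n + 1)) - (1 - x ^ (k + 1)))
      = (x ^ (k + 1) - x ^ w) * (1 - x ^ n) + x ^ n * (1 - x) * (1 - x ^ w) := fun k => by
    rw [key, pow_succ x n]; ring
  have hn1 : x ^ n ≤ 1 := pow_le_one₀ hx0.le hx1.le
  have hw1 : x ^ w ≤ 1 := pow_le_one₀ hx0.le hx1.le
  refine sum_le_of_unimodal (fun k hk => ?_) fun k hk => ?_
  · refine le_of_mul_le_mul_left ?_ (hpos k)
    rw [step]
    refine mul_le_mul_of_nonneg_right ?_ (hnn k)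
    rw [← sub_nonneg]
    refine nonneg_of_mul_nonneg_right ?_ (sub_pos.2 hlt)
    rw [key']
    have := hmono (show k + 1 ≤ w from hk)
    exact add_nonneg (mul_nonneg (by linarith) (by linarith))
      (mul_nonneg (mul_nonneg (by positivity) (by linarith)) (by linarith))
  · refine le_of_mul_le_mul_left ?_ (hpos k)
    rw [step]
    refine mul_le_mul_of_nonneg_right ?_ (hnn k)
    rw [← sub_nonpos]
    refine nonpos_of_mul_nonpos_right ?_ (sub_pos.2 hlt)
    rw [key']
    have h1 := hmono (show w + 1 ≤ k + 1 by omega)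
    have h2 : (x ^ (k + 1) - x ^ w) * (1 - x ^ n) ≤ (x ^ (w + 1) - x ^ w) * (1 - x ^ n) :=
      mul_le_mul_of_nonneg_right (by linarith) (by linarith)
    have h3 : (x ^ (w + 1) - x ^ w) * (1 - x ^ n) + x ^ n * (1 - x) * (1 - x ^ w)
        = - ((1 - x) * (x ^ w - x ^ n)) := by rw [pow_succ]; ring
    have h4 : 0 ≤ (1 - x) * (x ^ w - x ^ n) := mul_nonneg (by linarith) (by linarith)
    linarith

theorem geomEsymm_mul_pow_le {x r : ℝ} (hx : 0 ≤ x) (hr : 0 ≤ r) {n w : ℕ} (hw : w ≤ n) :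
    geomEsymm x n w * r ^ w ≤ ∏ i ∈ Finset.range n, (1 + r * x ^ (i + 1)) := by
  rw [prod_one_add_geom]
  exact Finset.single_le_sum (f := fun k => geomEsymm x n k * r ^ k)
    (fun k _ => mul_nonneg (geomEsymm_nonneg hx n k) (pow_nonneg hr k))
    (Finset.mem_range.2 (Nat.lt_succ_of_le hw))

/-! ### Binomial coefficients and the binary entropy -/

theorem choose_mul_le_one {n w : ℕ} (hw : w ≤ n) {t : ℝ} (h0 : 0 ≤ t) (h1 : t ≤ 1) :
    (n.choose w : ℝ) * (t ^ w * (1 - t) ^ (n - w)) ≤ 1 := by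
  have h := add_pow t (1 - t) n
  rw [add_sub_cancel, one_pow] at h
  refine le_of_eq_of_le ?_ (Finset.single_le_sum
    (f := fun k => t ^ k * (1 - t) ^ (n - k) * (n.choose k : ℝ)) (fun k _ => ?_)
    (Finset.mem_range.2 (Nat.lt_succ_of_le hw)) |>.trans_eq h.symm)
  · ring
  · have : 0 ≤ 1 - t := by linarith
    positivity

/-- The binomial law with parameter w/n has its mode at w, so its n + 1 probabilities, which sum to
1, are all at most the one at w. With r = t/(1 - t), the ratio of consecutive terms C(n,k) r^k is
r(n - k)/(k + 1). -/
theorem one_le_choose_mul {n w : ℕ} (hw : w < n) :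
    1 ≤ (n + 1) * ((n.choose w : ℝ) * ((w / n : ℝ) ^ w * (1 - w / n) ^ (n - w))) := by
  have hn : (0 : ℝ) < n := by exact_mod_cast (Nat.zero_le w).trans_lt hw
  set t : ℝ := w / n with ht
  have h0 : 0 ≤ t := by positivity
  have hwn : (w : ℝ) < n := by exact_mod_cast hw
  have h1 : 0 < 1 - t := by rw [sub_pos, ht, div_lt_one hn]; exact hwn
  set r : ℝ := t / (1 - t) with hr
  have hr0 : 0 ≤ r := by positivity
  have hrw : r * (n - w) = w := by
    have : (n : ℝ) - w ≠ 0 := by linarith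
    rw [hr, ht]
    field_simp
  have hsum : ∑ k ∈ Finset.range (n + 1), (n.choose k : ℝ) * r ^ k = (1 + r) ^ n := by
    rw [add_comm 1 r, add_pow]
    exact Finset.sum_congr rfl fun k _ => by ring
  have step : ∀ k : ℕ, ((k : ℝ) + 1) * ((n.choose (k + 1) : ℝ) * r ^ (k + 1))
      = (n.choose k : ℝ) * r ^ k * (r * (n - k : ℕ)) := fun k => by
    have := Nat.choose_succ_right_eq n k
    have : (n.choose (k + 1) : ℝ) * (k + 1) = n.choose k * (n - k : ℕ) := by exact_mod_cast this
    rw [pow_succ]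
    linear_combination r ^ k * r * this
  have hmode : ∑ k ∈ Finset.range (n + 1), (n.choose k : ℝ) * r ^ k
      ≤ (n + 1) * ((n.choose w : ℝ) * r ^ w) := by
    refine sum_le_of_unimodal (c := fun k => (n.choose k : ℝ) * r ^ k)
      (fun k hk => ?_) fun k hk => ?_
    · refine le_of_mul_le_mul_left ?_ (show (0 : ℝ) < k + 1 by positivity)
      rw [step, mul_comm]
      refine mul_le_mul_of_nonneg_left ?_ (by positivity)
      have hkn : ((n - k : ℕ) : ℝ) = n - k := by rw [Nat.cast_sub (by omega)]
      have : (k : ℝ) + 1 ≤ w := by exact_mod_cast hk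
      rw [hkn]
      nlinarith
    · refine le_of_mul_le_mul_left ?_ (show (0 : ℝ) < k + 1 by positivity)
      rw [step, mul_comm (_ + _ : ℝ)]
      refine mul_le_mul_of_nonneg_left ?_ (by positivity)
      have hkn : ((n - k : ℕ) : ℝ) ≤ n - w := by
        rw [← Nat.cast_sub hw.le]; exact_mod_cast Nat.sub_le_sub_left hk n
      have : (w : ℝ) ≤ k := by exact_mod_cast hk
      nlinarith
  rw [hsum] at hmode
  have h1r : 1 + r = (1 - t)⁻¹ := by rw [hr]; field_simp; ring
  have hmul := mul_le_mul_of_nonneg_right hmode (pow_nonneg h1.le n)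
  rw [h1r, ← mul_pow, inv_mul_cancel₀ h1.ne', one_pow] at hmul
  refine hmul.trans_eq ?_
  have : (1 - t) ^ n = (1 - t) ^ w * (1 - t) ^ (n - w) := by rw [← pow_add]; congr 1; omega
  rw [this, hr, div_pow]
  field_simp

theorem log_pow_mul_pow_eq {n w : ℕ} (h0 : 0 < w) (hw : w < n) :
    Real.log ((w / n : ℝ) ^ w * (1 - w / n) ^ (n - w)) = - (n * Real.binEntropy (w / n)) := by
  have hn : (0 : ℝ) < n := by exact_mod_cast (Nat.zero_le w).trans_lt hw
  have hw' : (0 : ℝ) < w := by exact_mod_cast h0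
  have hwn : (w : ℝ) < n := by exact_mod_cast hw
  have h1 : (0 : ℝ) < 1 - w / n := by rw [sub_pos, div_lt_one hn]; exact hwn
  rw [Real.log_mul (by positivity) (by positivity), Real.log_pow, Real.log_pow, Real.binEntropy,
    Real.log_inv, Real.log_inv, Nat.cast_sub hw.le]
  field_simp
  ring

theorem log_choose_le {n w : ℕ} (hn : 0 < n) (hw : w ≤ n) :
    Real.log (n.choose w) ≤ n * Real.binEntropy (w / n) := by
  have hn' : (n : ℝ) ≠ 0 := by exact_mod_cast hn.ne'
  rcases Nat.eq_zero_or_pos w with rfl | h0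
  · simp
  rcases hw.eq_or_lt with rfl | hlt
  · simp [hn']
  have hw' : (0 : ℝ) < w := by exact_mod_cast h0
  have hwn : (w : ℝ) < n := by exact_mod_cast hlt
  have hnp : (0 : ℝ) < n := by exact_mod_cast hn
  have h1 : (0 : ℝ) < 1 - w / n := by rw [sub_pos, div_lt_one hnp]; exact hwn
  have hc : (0 : ℝ) < n.choose w := by exact_mod_cast Nat.choose_pos hw
  have h := choose_mul_le_one hw (t := w / n) (by positivity) (by linarith)
  have := Real.log_le_log (by positivity) h
  rw [Real.log_mul hc.ne' (by positivity), log_pow_mul_pow_eq h0 hlt, Real.log_one] at this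
  linarith

theorem le_log_choose {n w : ℕ} (hn : 0 < n) (hw : w ≤ n) :
    n * Real.binEntropy (w / n) - Real.log (n + 1) ≤ Real.log (n.choose w) := by
  have hn' : (n : ℝ) ≠ 0 := by exact_mod_cast hn.ne'
  have hlog : 0 ≤ Real.log ((n : ℝ) + 1) := Real.log_nonneg (by linarith [n.cast_nonneg (α := ℝ)])
  rcases Nat.eq_zero_or_pos w with rfl | h0
  · simpa using hlog
  rcases hw.eq_or_lt with rfl | hlt
  · simpa [hn'] using hlog
  have hw' : (0 : ℝ) < w := by exact_mod_cast h0
  have hwn : (w : ℝ) < n := by exact_mod_cast hlt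
  have hnp : (0 : ℝ) < n := by exact_mod_cast hn
  have h1 : (0 : ℝ) < 1 - w / n := by rw [sub_pos, div_lt_one hnp]; exact hwn
  have hc : (0 : ℝ) < n.choose w := by exact_mod_cast Nat.choose_pos hw
  have := Real.log_le_log one_pos (one_le_choose_mul hlt)
  rw [Real.log_mul (by positivity) (by positivity), Real.log_mul hc.ne' (by positivity),
    log_pow_mul_pow_eq h0 hlt, Real.log_one] at this
  linarith

/-! ### The integral J, the saddle point and the growth rate -/

theorem J_integrand_continuous {r : ℝ} (hr : 0 ≤ r) (γ : ℝ) :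
    Continuous fun x : ℝ => Real.log (1 + r * Real.exp (-γ * x)) := by
  refine Continuous.log (by fun_prop) fun x => ?_
  positivity

/-- The absolute value keeps the argument of the logarithm positive for every real r, so continuity
of parametric integrals applies globally. -/
theorem continuous_J_abs (γ : ℝ) : Continuous fun r : ℝ => J |r| γ := by
  unfold J
  refine intervalIntegral.continuous_parametric_intervalIntegral_of_continuous'
    (f := fun r x : ℝ => Real.log (1 + |r| * Real.exp (-γ * x))) ?_ 0 1
  refine Continuous.log (by fun_prop) fun x => ?_
  positivity

theorem continuousOn_J (γ : ℝ) : ContinuousOn (fun r : ℝ => J r γ) (Set.Ici 0) :=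
  (continuous_J_abs γ).continuousOn.congr fun r hr => by
    simp only [abs_of_nonneg (Set.mem_Ici.1 hr)]

theorem J_zero (γ : ℝ) : J 0 γ = 0 := by simp [J]

theorem J_le_log {r : ℝ} (hr : 0 ≤ r) {γ : ℝ} (hγ : 0 ≤ γ) : J r γ ≤ Real.log (1 + r) := by
  have h := intervalIntegral.integral_mono_on (a := 0) (b := 1) (μ := MeasureTheory.volume)
    zero_le_one
    ((J_integrand_continuous hr γ).intervalIntegrable 0 1)
    (intervalIntegrable_const (c := Real.log (1 + r))) fun x hx => ?_
  · simpa [J] using h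
  · refine Real.log_le_log (by positivity) ?_
    have : Real.exp (-γ * x) ≤ 1 := Real.exp_le_one_iff.2 (by nlinarith [hx.1])
    nlinarith

theorem J_pos {r : ℝ} (hr : 0 < r) (γ : ℝ) : 0 < J r γ := by
  refine intervalIntegral.intervalIntegral_pos_of_pos
    ((J_integrand_continuous hr.le γ).intervalIntegrable 0 1) (fun x => ?_) zero_lt_one
  exact Real.log_pos (by have := Real.exp_pos (-γ * x); nlinarith)

theorem saddle_denom_pos {t β : ℝ} (hβ : 0 < β) (ht : t < 1) :
    0 < 1 - Real.exp (β * (t - 1)) := by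
  rw [sub_pos, Real.exp_lt_one_iff]
  nlinarith

theorem saddle_num_pos {t β : ℝ} (hβ : 0 < β) (ht : 0 < t) : 0 < Real.exp (β * t) - 1 := by
  rw [sub_pos, Real.one_lt_exp_iff]
  positivity

theorem saddle_pos {t β : ℝ} (hβ : 0 < β) (h0 : 0 < t) (h1 : t < 1) : 0 < saddle t β :=
  div_pos (saddle_num_pos hβ h0) (saddle_denom_pos hβ h1)

theorem saddle_zero (β : ℝ) : saddle 0 β = 0 := by simp [saddle]

theorem saddle_nonneg {t β : ℝ} (hβ : 0 < β) (h0 : 0 ≤ t) (h1 : t < 1) : 0 ≤ saddle t β := by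
  rcases h0.eq_or_lt with rfl | h0
  · rw [saddle_zero]
  · exact (saddle_pos hβ h0 h1).le

theorem growth_zero (β : ℝ) : growth 0 β = 0 := by simp [growth, saddle_zero, J_zero]

theorem growth_one (β : ℝ) : growth 1 β = -β / 2 := by simp [growth]

theorem growth_of_lt {t : ℝ} (ht : t < 1) (β : ℝ) :
    growth t β = J (saddle t β) β - t * Real.log (saddle t β) := by
  rw [growth, if_neg ht.ne]

/-- The stationarity equation of the saddle point. -/
theorem integral_saddle {t β : ℝ} (hβ : 0 < β) (h0 : 0 < t) (h1 : t < 1) :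
    ∫ x in (0 : ℝ)..1, saddle t β * Real.exp (-β * x) / (1 + saddle t β * Real.exp (-β * x)) = t := by
  have hr := saddle_pos hβ h0 h1
  set r := saddle t β with hrdef
  have hd : ∀ x ∈ Set.uIcc (0 : ℝ) 1,
      HasDerivAt (fun x => -(1 / β) * Real.log (1 + r * Real.exp (-β * x)))
        (r * Real.exp (-β * x) / (1 + r * Real.exp (-β * x))) x := fun x _ => by
    have h2 : HasDerivAt (fun x : ℝ => -β * x) (-β) x := by
      simpa using (hasDerivAt_id x).const_mul (-β)
    have h3 := (((h2.exp.const_mul r).const_add 1).log (by positivity)).const_mul (-(1 / β))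
    refine h3.congr_deriv ?_
    field_simp
  rw [intervalIntegral.integral_eq_sub_of_hasDerivAt hd
    (Continuous.intervalIntegrable (by
      refine Continuous.div (by fun_prop) (by fun_prop) fun x => ?_
      positivity) _ _)]
  have hD := saddle_denom_pos hβ h1
  have e1 : Real.exp (β * (t - 1)) = Real.exp (β * t) * Real.exp (-β) := by
    rw [← Real.exp_add]; congr 1; ring
  -- The definition of the saddle point solved in this form; the integral is log((1 + r)/(1 + r
  -- e^{-β}))/β.
  have hq : 1 + r = Real.exp (β * t) * (1 + r * Real.exp (-β)) := by
    rw [hrdef, saddle]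
    rw [e1] at hD ⊢
    field_simp
    ring
  have hl : Real.log (1 + r) = β * t + Real.log (1 + r * Real.exp (-β)) := by
    rw [hq, Real.log_mul (by positivity) (by positivity), Real.log_exp]
  simp only [mul_zero, Real.exp_zero, mul_one]
  rw [hl]
  field_simp
  ring

/-- As a function of log s, log(1 + s y) is strictly convex; this is its tangent at log r. It comes
from Jensen's inequality for log at the points 1 and s/r with weights 1/(1 + r y) and r y/(1 + r y).
-/
theorem log_tangent_lt {y r s : ℝ} (hy : 0 < y) (hr : 0 < r) (hs : 0 < s) (hrs : s ≠ r) :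
    Real.log (1 + r * y) + r * y / (1 + r * y) * (Real.log s - Real.log r)
      < Real.log (1 + s * y) := by
  have hne : (1 : ℝ) ≠ s / r := fun h => hrs (by field_simp at h; exact h.symm)
  have ha : 0 < 1 / (1 + r * y) := by positivity
  have hb : 0 < r * y / (1 + r * y) := by positivity
  have h := strictConcaveOn_log_Ioi.2 (Set.mem_Ioi.2 one_pos)
    (Set.mem_Ioi.2 (div_pos hs hr)) hne ha hb (by field_simp)
  simp only [smul_eq_mul, Real.log_one, mul_zero, zero_add, mul_one] at h
  rw [Real.log_div hs.ne' hr.ne'] at h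
  have e : 1 / (1 + r * y) + r * y / (1 + r * y) * (s / r) = (1 + s * y) / (1 + r * y) := by
    field_simp
  rw [e, Real.log_div (by positivity) (by positivity)] at h
  linarith

theorem log_tangent_le {y r s : ℝ} (hy : 0 < y) (hr : 0 < r) (hs : 0 < s) :
    Real.log (1 + r * y) + r * y / (1 + r * y) * (Real.log s - Real.log r)
      ≤ Real.log (1 + s * y) := by
  rcases eq_or_ne s r with rfl | h
  · simp
  · exact (log_tangent_lt hy hr hs h).le

theorem integral_tangent {t β : ℝ} (hβ : 0 < β) (h0 : 0 < t) (h1 : t < 1) (c : ℝ) :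
    ∫ x in (0 : ℝ)..1, (Real.log (1 + saddle t β * Real.exp (-β * x))
      + saddle t β * Real.exp (-β * x) / (1 + saddle t β * Real.exp (-β * x)) * c)
      = J (saddle t β) β + t * c := by
  have hr := saddle_pos hβ h0 h1
  rw [intervalIntegral.integral_add ((J_integrand_continuous hr.le β).intervalIntegrable _ _),
    intervalIntegral.integral_mul_const, integral_saddle hβ h0 h1, J]
  refine Continuous.intervalIntegrable ?_ _ _
  refine (Continuous.div (by fun_prop) (by fun_prop) fun x => ?_).mul_const _
  positivity

theorem continuous_tangent {r : ℝ} (hr : 0 < r) (β c : ℝ) :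
    Continuous fun x : ℝ => Real.log (1 + r * Real.exp (-β * x))
      + r * Real.exp (-β * x) / (1 + r * Real.exp (-β * x)) * c := by
  refine (J_integrand_continuous hr.le β).add ?_
  refine (Continuous.div (by fun_prop) (by fun_prop) fun x => ?_).mul_const _
  positivity

/-- Integrate the tangent bound at the saddle point: its slope integrates to t by `integral_saddle`.
Thus growth is the minimum over s of J(s; β) - t log s, and any s gives an upper bound. -/
theorem growth_le_of_pos {t s β : ℝ} (hβ : 0 < β) (h0 : 0 < t) (h1 : t < 1) (hs : 0 < s) :
    growth t β ≤ J s β - t * Real.log s := by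
  have hr := saddle_pos hβ h0 h1
  have h := intervalIntegral.integral_mono_on (a := 0) (b := 1) (μ := MeasureTheory.volume)
    zero_le_one
    ((continuous_tangent hr β (Real.log s - Real.log (saddle t β))).intervalIntegrable 0 1)
    ((J_integrand_continuous hs.le β).intervalIntegrable 0 1)
    fun x _ => log_tangent_le (Real.exp_pos _) hr hs
  rw [integral_tangent hβ h0 h1] at h
  rw [growth_of_lt h1, show J s β = ∫ x in (0 : ℝ)..1, _ from rfl]
  linarith

theorem growth_lt_of_ne {t s β : ℝ} (hβ : 0 < β) (h0 : 0 < t) (h1 : t < 1) (hs : 0 < s)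
    (hne : s ≠ saddle t β) : growth t β < J s β - t * Real.log s := by
  have hr := saddle_pos hβ h0 h1
  have h := intervalIntegral.integral_lt_integral_of_continuousOn_of_le_of_exists_lt
    (a := 0) (b := 1) zero_lt_one
    (continuous_tangent hr β (Real.log s - Real.log (saddle t β))).continuousOn
    (J_integrand_continuous hs.le β).continuousOn
    (fun x _ => log_tangent_le (Real.exp_pos _) hr hs)
    ⟨0, by simp, log_tangent_lt (Real.exp_pos _) hr hs hne⟩
  rw [integral_tangent hβ h0 h1] at h
  rw [growth_of_lt h1, show J s β = ∫ x in (0 : ℝ)..1, _ from rfl]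
  linarith

/-- Test the minimum with s = t/(1 - t), the optimal choice for β = 0, and use J(s; β) ≤ log(1 + s).
This determines the min-entropy rate. -/
theorem growth_le_binEntropy {t β : ℝ} (hβ : 0 < β) (h0 : 0 ≤ t) (h1 : t ≤ 1) :
    growth t β ≤ Real.binEntropy t := by
  rcases h0.eq_or_lt with rfl | h0
  · simp [growth_zero]
  rcases h1.eq_or_lt with rfl | h1
  · rw [growth_one, Real.binEntropy_one]; linarith
  have h1' : 0 < 1 - t := by linarith
  have h := growth_le_of_pos hβ h0 h1 (s := t / (1 - t)) (by positivity)
  have h2 := J_le_log (r := t / (1 - t)) (by positivity) hβ.le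
  have e : 1 + t / (1 - t) = (1 - t)⁻¹ := by field_simp; ring
  rw [e, Real.log_inv] at h2
  rw [Real.log_div h0.ne' h1'.ne'] at h
  rw [Real.binEntropy, Real.log_inv, Real.log_inv]
  linarith

/-- The maximizer of `growth`, where the saddle point is `1`. -/
noncomputable def typicalWeight (β : ℝ) : ℝ := Real.log (2 / (1 + Real.exp (-β))) / β

theorem typicalWeight_pos {β : ℝ} (hβ : 0 < β) : 0 < typicalWeight β := by
  refine div_pos (Real.log_pos ?_) hβ
  have : Real.exp (-β) < 1 := Real.exp_lt_one_iff.2 (by linarith)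
  rw [lt_div_iff₀ (by positivity)]
  linarith

theorem typicalWeight_lt_one {β : ℝ} (hβ : 0 < β) : typicalWeight β < 1 := by
  rw [typicalWeight, div_lt_one hβ, Real.log_lt_iff_lt_exp (by positivity),
    div_lt_iff₀ (by positivity), mul_add, ← Real.exp_add]
  have : 1 < Real.exp β := Real.one_lt_exp_iff.2 hβ
  simp only [add_neg_cancel, Real.exp_zero]
  linarith

theorem saddle_eq_one_iff {t β : ℝ} (hβ : 0 < β) (h1 : t < 1) :
    saddle t β = 1 ↔ t = typicalWeight β := by
  have e1 : Real.exp (β * (t - 1)) = Real.exp (β * t) * Real.exp (-β) := by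
    rw [← Real.exp_add]; congr 1; ring
  rw [saddle, div_eq_one_iff_eq (saddle_denom_pos hβ h1).ne', e1, typicalWeight,
    eq_div_iff hβ.ne', mul_comm t]
  constructor
  · intro h
    rw [← Real.log_exp (β * t)]
    congr 1
    rw [eq_div_iff (by positivity)]
    linarith
  · intro h
    rw [h, Real.exp_log (by positivity)]
    field_simp
    ring

theorem growth_typicalWeight {β : ℝ} (hβ : 0 < β) : growth (typicalWeight β) β = J 1 β := by
  have h1 := typicalWeight_lt_one hβ
  rw [growth_of_lt h1, (saddle_eq_one_iff hβ h1).2 rfl]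
  simp

/-- Test the minimum with s = 1: the inequality is strict unless the saddle point is 1. Uniqueness
of the maximizer is what makes the Shannon rate exist. -/
theorem growth_lt_J_one {t β : ℝ} (hβ : 0 < β) (h0 : 0 ≤ t) (h1 : t ≤ 1)
    (hne : t ≠ typicalWeight β) : growth t β < J 1 β := by
  have hJ := J_pos one_pos β
  rcases h0.eq_or_lt with rfl | h0
  · rwa [growth_zero]
  rcases h1.eq_or_lt with rfl | h1
  · rw [growth_one]; linarith
  simpa using growth_lt_of_ne hβ h0 h1 one_pos
    fun h => hne ((saddle_eq_one_iff hβ h1).1 h.symm)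

/-! ### Continuity of the growth rate -/

/-- Factor r e^{-βx} out of 1 + r e^{-βx} and substitute x ↦ 1 - x. -/
theorem J_reflect {r β : ℝ} (hr : 0 < r) :
    J r β = Real.log r - β / 2 + J (Real.exp β / r) β := by
  have h : J (Real.exp β / r) β
      = ∫ x in (0 : ℝ)..1, Real.log (1 + Real.exp β / r * Real.exp (-β * (1 - x))) := by
    rw [intervalIntegral.integral_comp_sub_left
      (fun x => Real.log (1 + Real.exp β / r * Real.exp (-β * x))) 1]
    simp [J]
  have hpt : ∀ x : ℝ, Real.log (1 + Real.exp β / r * Real.exp (-β * (1 - x)))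
      = Real.log (1 + r * Real.exp (-β * x)) + (β * x - Real.log r) := fun x => by
    have e : 1 + Real.exp β / r * Real.exp (-β * (1 - x))
        = (1 + r * Real.exp (-β * x)) * (Real.exp (β * x) / r) := by
      have h1 : Real.exp (-β * (1 - x)) = Real.exp (β * x) * Real.exp (-β) := by
        rw [← Real.exp_add]; congr 1; ring
      have h2 : Real.exp (-(β * x)) * Real.exp (β * x) = 1 := by
        rw [← Real.exp_add]; simp
      have h3 : Real.exp β * Real.exp (-β) = 1 := by
        rw [← Real.exp_add]; simp
      rw [h1, neg_mul]
      field_simp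
      linear_combination Real.exp (β * x) * h3 - r * h2
    rw [e, Real.log_mul (by positivity) (by positivity), Real.log_div (by positivity) hr.ne',
      Real.log_exp]
  rw [h, intervalIntegral.integral_congr fun x _ => hpt x, intervalIntegral.integral_add
    ((J_integrand_continuous hr.le β).intervalIntegrable _ _)
    (Continuous.intervalIntegrable (by fun_prop) _ _),
    intervalIntegral.integral_sub (Continuous.intervalIntegrable (by fun_prop) _ _)
      (by simp), intervalIntegral.integral_const_mul, integral_id]
  simp only [intervalIntegral.integral_const, J]
  simp
  ring

theorem saddle_reflect {t β : ℝ} (hβ : 0 < β) (h0 : 0 < t) (h1 : t < 1) :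
    Real.exp β / saddle t β = saddle (1 - t) β := by
  have hD := saddle_denom_pos hβ h1
  have hN := saddle_num_pos hβ h0
  have hD' := saddle_denom_pos hβ (show 1 - t < 1 by linarith)
  have e1 : Real.exp (β * (t - 1)) = Real.exp (β * t) * Real.exp (-β) := by
    rw [← Real.exp_add]; congr 1; ring
  have e2 : Real.exp (β * (1 - t)) = Real.exp β * Real.exp (-(β * t)) := by
    rw [← Real.exp_add]; congr 1; ring
  have e3 : Real.exp (β * (1 - t - 1)) = Real.exp (-(β * t)) := by congr 1; ring
  have h2 : Real.exp (-(β * t)) * Real.exp (β * t) = 1 := by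
    rw [← Real.exp_add]; simp
  have h3 : Real.exp β * Real.exp (-β) = 1 := by
    rw [← Real.exp_add]; simp
  rw [saddle, saddle, div_div_eq_mul_div, div_eq_div_iff hN.ne' hD'.ne', e1, e2, e3]
  linear_combination (-Real.exp (β * t) + 1) * h3 - Real.exp β * h2 + h2 * Real.exp β * Real.exp (-β)

/-- The limit form of complementing the index sets in e_w. It carries continuity from t = 0 to t =
1, where the saddle point is infinite. -/
theorem growth_reflect {t β : ℝ} (hβ : 0 < β) (h0 : 0 ≤ t) (h1 : t ≤ 1) :
    growth t β = growth (1 - t) β + β * (1 / 2 - t) := by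
  rcases h0.eq_or_lt with rfl | h0
  · rw [sub_zero, growth_zero, growth_one]; ring
  rcases h1.eq_or_lt with rfl | h1
  · rw [sub_self, growth_zero, growth_one]; ring
  have hr := saddle_pos hβ h0 h1
  rw [growth_of_lt h1, growth_of_lt (show 1 - t < 1 by linarith), J_reflect hr,
    ← saddle_reflect hβ h0 h1, Real.log_div (by positivity) hr.ne', Real.log_exp]
  ring

theorem continuousOn_saddle {β : ℝ} (hβ : 0 < β) :
    ContinuousOn (fun t => saddle t β) (Set.Iio 1) := by
  unfold saddle
  refine ContinuousOn.div (by fun_prop) (by fun_prop) fun t ht => ?_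
  exact (saddle_denom_pos hβ ht).ne'

/-- Only t = 0 is delicate. With u = e^{βt} - 1 ≥ βt, the function is bounded by |u log u|/β, which
tends to 0. -/
theorem continuousOn_mul_log_exp_sub_one {β : ℝ} (hβ : 0 < β) :
    ContinuousOn (fun t => t * Real.log (Real.exp (β * t) - 1)) (Set.Ici 0) := by
  intro t ht
  rcases (Set.mem_Ici.1 ht).eq_or_lt with rfl | ht
  · rw [ContinuousWithinAt, zero_mul]
    have hlim : Tendsto (fun t : ℝ => 1 / β * |(Real.exp (β * t) - 1)
        * Real.log (Real.exp (β * t) - 1)|) (𝓝[Set.Ici 0] 0) (𝓝 0) := by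
      have hc : Continuous fun t : ℝ => 1 / β * |(Real.exp (β * t) - 1)
          * Real.log (Real.exp (β * t) - 1)| :=
        ((Real.continuous_mul_log.comp (by fun_prop :
          Continuous fun t : ℝ => Real.exp (β * t) - 1)).abs).const_mul _
      have := (hc.tendsto 0).mono_left (nhdsWithin_le_nhds (s := Set.Ici 0))
      simpa using this
    refine squeeze_zero_norm' ?_ hlim
    filter_upwards [self_mem_nhdsWithin] with t ht
    have ht0 : 0 ≤ t := ht
    have hle : β * t ≤ Real.exp (β * t) - 1 := by linarith [Real.add_one_le_exp (β * t)]
    rw [Real.norm_eq_abs, abs_mul, abs_mul, ← mul_assoc]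
    refine mul_le_mul_of_nonneg_right ?_ (abs_nonneg _)
    rw [abs_of_nonneg ht0, abs_of_nonneg ((by positivity : 0 ≤ β * t).trans hle),
      one_div, ← div_eq_inv_mul, le_div_iff₀ hβ]
    linarith
  · refine (ContinuousAt.mul continuousAt_id ?_).continuousWithinAt
    exact ContinuousAt.log (by fun_prop) (saddle_num_pos hβ ht).ne'

theorem continuousOn_growth_Ico {β : ℝ} (hβ : 0 < β) :
    ContinuousOn (fun t => growth t β) (Set.Ico 0 1) := by
  have h1 : ContinuousOn (fun t => J (saddle t β) β) (Set.Ico 0 1) :=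
    (continuousOn_J β).comp ((continuousOn_saddle hβ).mono fun t ht => ht.2)
      fun t ht => saddle_nonneg hβ ht.1 ht.2
  have h2 : ContinuousOn (fun t => t * Real.log (1 - Real.exp (β * (t - 1)))) (Set.Ico 0 1) :=
    continuousOn_id.mul (ContinuousOn.log (by fun_prop)
      fun t ht => (saddle_denom_pos hβ ht.2).ne')
  have h3 := (continuousOn_mul_log_exp_sub_one hβ).mono
    (Set.Ico_subset_Ici_self : Set.Ico (0 : ℝ) 1 ⊆ _)
  refine (h1.sub (h3.sub h2)).congr fun t ht => ?_
  simp only [growth_of_lt ht.2]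
  rcases ht.1.eq_or_lt with rfl | h0
  · simp
  · have h4 : Real.log (saddle t β)
        = Real.log (Real.exp (β * t) - 1) - Real.log (1 - Real.exp (β * (t - 1))) :=
      Real.log_div (saddle_num_pos hβ h0).ne' (saddle_denom_pos hβ ht.2).ne'
    rw [h4]
    simp only [Pi.sub_apply]
    ring

theorem continuousOn_growth {β : ℝ} (hβ : 0 < β) :
    ContinuousOn (fun t => growth t β) (Set.Icc 0 1) := by
  have hIoc : ContinuousOn (fun t => growth t β) (Set.Ioc 0 1) := by
    have h : ContinuousOn (fun t => growth (1 - t) β + β * (1 / 2 - t)) (Set.Ioc 0 1) :=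
      ((continuousOn_growth_Ico hβ).comp (f := fun t : ℝ => 1 - t) (by fun_prop)
        fun t ht => ⟨by linarith [ht.2], by linarith [ht.1]⟩).add (by fun_prop)
    exact h.congr fun t ht => growth_reflect hβ ht.1.le ht.2
  intro t ht
  rcases lt_or_ge t (1 / 2) with h | h
  · refine (continuousOn_growth_Ico hβ t ⟨ht.1, by linarith⟩).mono_of_mem_nhdsWithin ?_
    filter_upwards [self_mem_nhdsWithin, mem_nhdsWithin_of_mem_nhds (Iio_mem_nhds h)] with s hs hs'
    exact ⟨hs.1, by linarith [Set.mem_Iio.1 hs']⟩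
  · refine (hIoc t ⟨by linarith, ht.2⟩).mono_of_mem_nhdsWithin ?_
    filter_upwards [self_mem_nhdsWithin,
      mem_nhdsWithin_of_mem_nhds (Ioi_mem_nhds (show 0 < t by linarith))] with s hs hs'
    exact ⟨hs', hs.2⟩

/-! ### The law of the noise effect -/

/-- The base `e^{-β / n}` of the geometric progression of the likelihood ratios. -/
noncomputable def base (β : ℝ) (n : ℕ) : ℝ := Real.exp (-β / n)

theorem base_pos (β : ℝ) (n : ℕ) : 0 < base β n := Real.exp_pos _

theorem exp_rank (β : ℝ) (n : ℕ) (i : Fin n) :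
    Real.exp (-β * ((i : ℕ) + 1 : ℝ) / n) = base β n ^ ((i : ℕ) + 1) := by
  rw [base, ← Real.exp_nat_mul]
  congr 1
  push_cast
  ring

/-- The normalizing constant `∏ (1 + e^{-β i / n})`. -/
noncomputable def partitionFun (β : ℝ) (n : ℕ) : ℝ :=
  ∏ i ∈ Finset.range n, (1 + base β n ^ (i + 1))

theorem partitionFun_pos (β : ℝ) (n : ℕ) : 0 < partitionFun β n :=
  Finset.prod_pos fun _ _ => by have := base_pos β n; positivity

/-- The probability that the flipped bits are exactly those in `s`, up to normalization. -/
noncomputable def flipWeight (x : ℝ) {n : ℕ} (s : Finset (Fin n)) : ℝ :=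
  ∑ τ : Equiv.Perm (Fin n), ∏ i ∈ s, x ^ ((τ i : ℕ) + 1)

theorem flipWeight_map (x : ℝ) {n : ℕ} (s : Finset (Fin n)) (σ : Equiv.Perm (Fin n)) :
    flipWeight x (s.map σ.toEmbedding) = flipWeight x s := by
  refine Fintype.sum_equiv (Equiv.mulRight σ) _ _ fun τ => ?_
  simp [Finset.prod_map]

theorem exists_perm_map_eq {n : ℕ} {s t : Finset (Fin n)} (h : s.card = t.card) :
    ∃ σ : Equiv.Perm (Fin n), s.map σ.toEmbedding = t := by
  have e : {i // i ∈ s} ≃ {i // i ∈ t} := Fintype.equivOfCardEq (by simpa using h)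
  refine ⟨e.extendSubtype, Finset.eq_of_subset_of_card_le (fun i hi => ?_) (by simp [h])⟩
  obtain ⟨j, hj, rfl⟩ := Finset.mem_map.1 hi
  exact e.extendSubtype_mem j hj

theorem flipWeight_eq_of_card_eq (x : ℝ) {n : ℕ} {s t : Finset (Fin n)} (h : s.card = t.card) :
    flipWeight x s = flipWeight x t := by
  obtain ⟨σ, rfl⟩ := exists_perm_map_eq h
  rw [flipWeight_map]

/-- Only the size of s matters, so s may be replaced by a subset of t; the extra factors of t are at
most 1. -/
theorem flipWeight_anti {x : ℝ} (h0 : 0 ≤ x) (h1 : x ≤ 1) {n : ℕ} {s t : Finset (Fin n)}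
    (h : s.card ≤ t.card) : flipWeight x t ≤ flipWeight x s := by
  obtain ⟨u, hu, hc⟩ := Finset.exists_subset_card_eq h
  rw [← flipWeight_eq_of_card_eq x hc]
  refine Finset.sum_le_sum fun τ _ => ?_
  exact Finset.prod_le_prod_of_subset_of_le_one hu (fun i _ => by positivity)
    fun i _ _ => pow_le_one₀ h0 h1

theorem sum_powersetCard_perm (x : ℝ) (n w : ℕ) (τ : Equiv.Perm (Fin n)) :
    ∑ s ∈ Finset.powersetCard w (Finset.univ : Finset (Fin n)), ∏ i ∈ s, x ^ ((τ i : ℕ) + 1)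
      = geomEsymm x n w := by
  have hr : Finset.range n = (Finset.univ : Finset (Fin n)).map
      (τ.toEmbedding.trans Fin.valEmbedding) := by
    rw [← Finset.map_map]
    simp [Nat.Iio_eq_range]
  rw [geomEsymm, hr, Finset.powersetCard_map, Finset.sum_map]
  refine Finset.sum_congr rfl fun s _ => ?_
  simp [Finset.mapEmbedding_apply]

/-- Double counting: sum over all sets of the size of s. They have equal weights, while for each
fixed permutation the sum is the same elementary symmetric polynomial. -/
theorem choose_mul_flipWeight (x : ℝ) {n : ℕ} (s : Finset (Fin n)) :
    (n.choose s.card : ℝ) * flipWeight x s = (n.factorial : ℝ) * geomEsymm x n s.card := by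
  have h : ∑ t ∈ Finset.powersetCard s.card (Finset.univ : Finset (Fin n)), flipWeight x t
      = (n.choose s.card : ℝ) * flipWeight x s := by
    rw [Finset.sum_congr rfl fun t ht =>
      flipWeight_eq_of_card_eq x (Finset.mem_powersetCard.1 ht).2]
    simp
  rw [← h]
  unfold flipWeight
  rw [Finset.sum_comm, Finset.sum_congr rfl fun τ _ => sum_powersetCard_perm x n s.card τ]
  simp [Fintype.card_perm]

/-- The set of flipped bits. -/
def flips {n : ℕ} (z : Word n) : Finset (Fin n) := Finset.univ.filter fun i => z i ≠ 0

theorem card_flips {n : ℕ} (z : Word n) : (flips z).card = hammingNorm z := rfl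

/-- The flip and no-flip probabilities of one bit share the denominator 1 + x^i, and the product of
these over all ranks does not depend on the permutation. -/
theorem prod_bitProb (β : ℝ) (n : ℕ) (τ : Equiv.Perm (Fin n)) (x z : Word n) :
    ∏ i, bitProb (flipProb β n (τ i)) (x i) ((x + z) i)
      = (∏ i ∈ flips z, base β n ^ ((τ i : ℕ) + 1)) / partitionFun β n := by
  have hb : ∀ i, bitProb (flipProb β n (τ i)) (x i) ((x + z) i)
      = (if z i ≠ 0 then base β n ^ ((τ i : ℕ) + 1) else 1)
        / (1 + base β n ^ ((τ i : ℕ) + 1)) := fun i => by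
    have := base_pos β n
    rw [bitProb, flipProb, exp_rank, Pi.add_apply]
    by_cases h : z i = 0
    · simp only [h, add_zero, ne_eq, not_true_eq_false, if_true, if_false]
      field_simp
      ring
    · simp [h]
  have hZ : ∏ i : Fin n, (1 + base β n ^ ((τ i : ℕ) + 1)) = partitionFun β n := by
    rw [Equiv.prod_comp τ fun i => 1 + base β n ^ ((i : ℕ) + 1), partitionFun,
      Finset.prod_range]
  rw [Finset.prod_congr rfl fun i _ => hb i, Finset.prod_div_distrib, hZ, flips,
    Finset.prod_filter]

theorem hardNoise_eq_bind (β : ℝ) (n : ℕ) (inp : PMF (Word n)) :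
    hardNoise β n inp = inp.bind fun x =>
      (PMF.uniformOfFintype (Equiv.Perm (Fin n))).bind fun τ =>
        (channel β n τ x).map fun y => x + y := by
  unfold hardNoise jointLaw
  simp only [PMF.map_bind, PMF.map_comp]
  rfl

theorem add_self_word {n : ℕ} (x : Word n) : x + x = 0 := by
  funext i
  exact CharTwo.add_self_eq_zero (x i)

theorem channel_map_apply (β : ℝ) (n : ℕ) (τ : Equiv.Perm (Fin n)) (x z : Word n) :
    (channel β n τ x).map (fun y => x + y) z
      = ENNReal.ofReal ((∏ i ∈ flips z, base β n ^ ((τ i : ℕ) + 1)) / partitionFun β n) := by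
  have hz : ∀ y, z = x + y ↔ y = x + z := fun y => by
    constructor
    · rintro rfl
      rw [← add_assoc, add_self_word, zero_add]
    · rintro rfl
      rw [← add_assoc, add_self_word, zero_add]
  rw [PMF.map_apply, tsum_eq_single (x + z), if_pos ((hz _).2 rfl), channel,
    PMF.ofFintype_apply, prod_bitProb]
  intro y hy
  rw [if_neg fun h => hy ((hz y).1 h)]

/-- The law of the noise effect is explicit and does not depend on the input law. -/
theorem hardNoise_toReal (β : ℝ) (n : ℕ) (inp : PMF (Word n)) (z : Word n) :
    (hardNoise β n inp z).toReal
      = flipWeight (base β n) (flips z) / (n.factorial * partitionFun β n) := by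
  have hb := base_pos β n
  have hZ := partitionFun_pos β n
  have hin : ∀ x : Word n, ((PMF.uniformOfFintype (Equiv.Perm (Fin n))).bind fun τ =>
      (channel β n τ x).map fun y => x + y) z = ENNReal.ofReal
        (flipWeight (base β n) (flips z) / (n.factorial * partitionFun β n)) := fun x => by
    rw [PMF.bind_apply, tsum_fintype]
    simp only [PMF.uniformOfFintype_apply, channel_map_apply, Fintype.card_perm, Fintype.card_fin]
    rw [← Finset.mul_sum, ← ENNReal.ofReal_sum_of_nonneg fun τ _ => by positivity,
      ← Finset.sum_div, ← flipWeight, ← ENNReal.ofReal_natCast,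
      ← ENNReal.ofReal_inv_of_pos (by positivity), ← ENNReal.ofReal_mul (by positivity)]
    congr 1
    field_simp
  rw [hardNoise_eq_bind, PMF.bind_apply]
  simp only [hin]
  rw [ENNReal.tsum_mul_right, PMF.tsum_coe, one_mul, ENNReal.toReal_ofReal]
  unfold flipWeight
  positivity

theorem hardNoise_toReal_eq (β : ℝ) (n : ℕ) (inp : PMF (Word n)) (z : Word n) :
    (hardNoise β n inp z).toReal = geomEsymm (base β n) n (hammingNorm z)
      / (n.choose (hammingNorm z) * partitionFun β n) := by
  have h := choose_mul_flipWeight (base β n) (flips z)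
  rw [card_flips] at h
  have hc : (0 : ℝ) < n.choose (hammingNorm z) := by
    exact_mod_cast Nat.choose_pos (by simpa using hammingNorm_le_card_fintype (x := z))
  have hZ := partitionFun_pos β n
  rw [hardNoise_toReal, div_eq_div_iff (by positivity) (by positivity)]
  linear_combination partitionFun β n * h

theorem hardNoise_toReal_pos (β : ℝ) (n : ℕ) (inp : PMF (Word n)) (z : Word n) :
    0 < (hardNoise β n inp z).toReal := by
  have hc : hammingNorm z ≤ n := by simpa using hammingNorm_le_card_fintype (x := z)
  rw [hardNoise_toReal_eq]
  exact div_pos (geomEsymm_pos (base_pos β n) hc)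
    (mul_pos (by exact_mod_cast Nat.choose_pos hc) (partitionFun_pos β n))

theorem hardNoise_anti {β : ℝ} (hβ : 0 ≤ β) (n : ℕ) (inp : PMF (Word n)) {y z : Word n}
    (h : hammingNorm y ≤ hammingNorm z) :
    (hardNoise β n inp z).toReal ≤ (hardNoise β n inp y).toReal := by
  have hZ := partitionFun_pos β n
  rw [hardNoise_toReal, hardNoise_toReal]
  refine div_le_div_of_nonneg_right (flipWeight_anti (base_pos β n).le ?_ h) (by positivity)
  exact Real.exp_le_one_iff.2 (div_nonpos_of_nonpos_of_nonneg (by linarith) (by positivity))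

theorem hardNoise_anti_guess {β : ℝ} (hβ : 0 ≤ β) {n : ℕ} (inp : PMF (Word n))
    {G : Word n → ℕ} (hG : IsHardGuessing n G) (y z : Word n) (h : G y ≤ G z) :
    (hardNoise β n inp z).toReal ≤ (hardNoise β n inp y).toReal := by
  refine hardNoise_anti hβ n inp ?_
  rcases h.eq_or_lt with h | h
  · rw [hG.bijOn.injOn (Set.mem_univ y) (Set.mem_univ z) h]
  · exact hG.weight_le y z h

theorem card_weight (n w : ℕ) :
    ((Finset.univ : Finset (Word n)).filter fun z => hammingNorm z = w).card = n.choose w := by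
  rw [← Finset.card_fin n, ← Finset.card_powersetCard, Finset.card_fin]
  refine Finset.card_bij (fun z _ => flips z) (fun z hz => ?_) (fun y _ z _ h => ?_)
    fun s hs => ?_
  · rw [Finset.mem_powersetCard, card_flips]
    exact ⟨Finset.subset_univ _, (Finset.mem_filter.1 hz).2⟩
  · have key : ∀ a b : ZMod 2, (a ≠ 0 ↔ b ≠ 0) → a = b := by decide
    funext i
    have := Finset.ext_iff.1 h i
    simp only [flips, Finset.mem_filter, Finset.mem_univ, true_and] at this
    exact key _ _ this
  · have hf : flips (fun i => if i ∈ s then (1 : ZMod 2) else 0) = s := by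
      ext i
      simp [flips]
    refine ⟨fun i => if i ∈ s then 1 else 0, ?_, hf⟩
    rw [Finset.mem_filter, ← card_flips, hf]
    exact ⟨Finset.mem_univ _, (Finset.mem_powersetCard.1 hs).2⟩

/-- The Rényi sum, grouped by Hamming weight. -/
theorem sum_hardNoise_rpow (β : ℝ) (n : ℕ) (inp : PMF (Word n)) (ρ : ℝ) :
    ∑ z, (hardNoise β n inp z).toReal ^ ρ = ∑ w ∈ Finset.range (n + 1),
      (n.choose w : ℝ) * (geomEsymm (base β n) n w / (n.choose w * partitionFun β n)) ^ ρ := by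
  rw [← Finset.sum_fiberwise_of_maps_to (t := Finset.range (n + 1)) (g := fun z => hammingNorm z)
    fun z _ => Finset.mem_range.2 (Nat.lt_succ_of_le
      (by simpa using hammingNorm_le_card_fintype (x := z)))]
  refine Finset.sum_congr rfl fun w _ => ?_
  rw [Finset.sum_congr rfl (g := fun _ =>
    (geomEsymm (base β n) n w / (n.choose w * partitionFun β n)) ^ ρ) fun z hz => by
      rw [hardNoise_toReal_eq, (Finset.mem_filter.1 hz).2],
    Finset.sum_const, card_weight, nsmul_eq_mul]

/-! ### Arikan's inequalities: guessing moments and Rényi sums -/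

theorem sum_inv_eq_harmonic {S : Type*} [Fintype S] {G : S → ℕ} {N : ℕ}
    (hG : Set.BijOn G Set.univ (Set.Icc 1 N)) :
    ∑ s, ((G s : ℝ))⁻¹ = (harmonic N : ℝ) := by
  rw [harmonic_eq_sum_Icc]
  push_cast
  refine Finset.sum_bij (fun s _ => G s) (fun s _ => ?_) (fun s _ t _ h => ?_) (fun k hk => ?_)
    fun s _ => rfl
  · simpa using hG.mapsTo (Set.mem_univ s)
  · exact hG.injOn (Set.mem_univ s) (Set.mem_univ t) h
  · obtain ⟨s, -, hs⟩ := hG.surjOn (show k ∈ Set.Icc 1 N by simpa using hk)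
    exact ⟨s, Finset.mem_univ s, hs⟩

/-- If the elements are listed in order of nonincreasing `f`, then the `k`-th value of `f` is at
most a fraction `1 / k` of the total. -/
theorem rank_mul_le_sum {S : Type*} [Fintype S] {G : S → ℕ} {N : ℕ}
    (hG : Set.BijOn G Set.univ (Set.Icc 1 N)) {f : S → ℝ} (hf : ∀ s, 0 ≤ f s)
    (hanti : ∀ s t, G s ≤ G t → f t ≤ f s) (s : S) : (G s : ℝ) * f s ≤ ∑ t, f t := by
  classical
  have hcard : (Finset.univ.filter fun t => G t ≤ G s).card = G s := by
    have : (Finset.univ.filter fun t => G t ≤ G s).image G = Finset.Icc 1 (G s) := by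
      ext k
      simp only [Finset.mem_image, Finset.mem_filter, Finset.mem_univ, true_and, Finset.mem_Icc]
      constructor
      · rintro ⟨t, ht, rfl⟩
        exact ⟨(hG.mapsTo (Set.mem_univ t)).1, ht⟩
      · rintro ⟨h1, h2⟩
        obtain ⟨t, -, ht⟩ := hG.surjOn (show k ∈ Set.Icc 1 N from
          ⟨h1, h2.trans (hG.mapsTo (Set.mem_univ s)).2⟩)
        exact ⟨t, ht ▸ h2, ht⟩
    have h := congrArg Finset.card this
    rw [Finset.card_image_of_injOn (hG.injOn.mono (Set.subset_univ _)), Nat.card_Icc] at h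
    simpa using h
  calc (G s : ℝ) * f s = ∑ t ∈ Finset.univ.filter fun t => G t ≤ G s, f s := by
        rw [Finset.sum_const, hcard, nsmul_eq_mul]
    _ ≤ ∑ t ∈ Finset.univ.filter fun t => G t ≤ G s, f t :=
        Finset.sum_le_sum fun t ht => hanti t s (Finset.mem_filter.1 ht).2
    _ ≤ ∑ t, f t := Finset.sum_le_sum_of_subset_of_nonneg (Finset.filter_subset _ _)
        fun t _ _ => hf t

section moments

variable {S : Type*} [Fintype S] {G : S → ℕ} {N : ℕ} {p : S → ℝ} {α : ℝ}

/-- With q = p^{1/(1+α)} and T = ∑ q, the summand is p G^α = q (G q)^α, and G q ≤ T by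
`rank_mul_le_sum`. For α < 0 the same estimate reverses. -/
theorem guess_moment_le_of_nonneg [Nonempty S] (hG : Set.BijOn G Set.univ (Set.Icc 1 N)) (hp : ∀ s, 0 < p s)
    (hanti : ∀ s t, G s ≤ G t → p t ≤ p s) (hα : 0 ≤ α) :
    ∑ s, p s * (G s : ℝ) ^ α ≤ (∑ s, p s ^ (1 / (1 + α))) ^ (1 + α) := by
  set T := ∑ s, p s ^ (1 / (1 + α)) with hT
  have h1 : 0 < 1 + α := by linarith
  have hT0 : 0 < T := Finset.sum_pos (fun s _ => Real.rpow_pos_of_pos (hp s) _)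
    Finset.univ_nonempty
  rw [Real.rpow_add hT0, Real.rpow_one]
  conv_rhs => rw [hT, Finset.sum_mul, ← hT]
  refine Finset.sum_le_sum fun s _ => ?_
  have hk := rank_mul_le_sum hG (f := fun s => p s ^ (1 / (1 + α)))
    (fun s => (Real.rpow_pos_of_pos (hp s) _).le)
    (fun s t h => Real.rpow_le_rpow (hp t).le (hanti s t h) (by positivity)) s
  have hq := Real.rpow_pos_of_pos (hp s) (1 / (1 + α))
  have hpow := Real.rpow_le_rpow (by positivity) hk hα
  rw [Real.mul_rpow (by positivity) hq.le] at hpow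
  have hps : p s = p s ^ (1 / (1 + α)) * (p s ^ (1 / (1 + α))) ^ α := by
    rw [← Real.rpow_mul (hp s).le, ← Real.rpow_add (hp s)]
    conv_lhs => rw [← Real.rpow_one (p s)]
    congr 1
    field_simp
  calc p s * (G s : ℝ) ^ α
      = p s ^ (1 / (1 + α)) * ((G s : ℝ) ^ α * (p s ^ (1 / (1 + α))) ^ α) := by
        conv_lhs => rw [hps]
        ring
    _ ≤ _ := mul_le_mul_of_nonneg_left hpow hq.le

theorem le_guess_moment_of_neg [Nonempty S] (hG : Set.BijOn G Set.univ (Set.Icc 1 N)) (hp : ∀ s, 0 < p s)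
    (hanti : ∀ s t, G s ≤ G t → p t ≤ p s) (hα1 : -1 < α) (hα : α < 0) :
    (∑ s, p s ^ (1 / (1 + α))) ^ (1 + α) ≤ ∑ s, p s * (G s : ℝ) ^ α := by
  set T := ∑ s, p s ^ (1 / (1 + α)) with hT
  have h1 : 0 < 1 + α := by linarith
  have hT0 : 0 < T := Finset.sum_pos (fun s _ => Real.rpow_pos_of_pos (hp s) _)
    Finset.univ_nonempty
  rw [Real.rpow_add hT0, Real.rpow_one]
  conv_lhs => rw [hT, Finset.sum_mul, ← hT]
  refine Finset.sum_le_sum fun s _ => ?_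
  have hk := rank_mul_le_sum hG (f := fun s => p s ^ (1 / (1 + α)))
    (fun s => (Real.rpow_pos_of_pos (hp s) _).le)
    (fun s t h => Real.rpow_le_rpow (hp t).le (hanti s t h) (by positivity)) s
  have hq := Real.rpow_pos_of_pos (hp s) (1 / (1 + α))
  have hGs : (0 : ℝ) < G s := by exact_mod_cast (hG.mapsTo (Set.mem_univ s)).1
  have hpow := Real.rpow_le_rpow_of_nonpos (mul_pos hGs hq) hk hα.le
  rw [Real.mul_rpow (by positivity) hq.le] at hpow
  have hps : p s = p s ^ (1 / (1 + α)) * (p s ^ (1 / (1 + α))) ^ α := by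
    rw [← Real.rpow_mul (hp s).le, ← Real.rpow_add (hp s)]
    conv_lhs => rw [← Real.rpow_one (p s)]
    congr 1
    field_simp
  calc p s ^ (1 / (1 + α)) * T ^ α
      ≤ p s ^ (1 / (1 + α)) * ((G s : ℝ) ^ α * (p s ^ (1 / (1 + α))) ^ α) :=
        mul_le_mul_of_nonneg_left hpow hq.le
    _ = p s * (G s : ℝ) ^ α := by
        conv_rhs => rw [hps]
        ring

/-- Hölder's inequality with exponents 1 + α and (1 + α)/α for p^{1/(1+α)} = (p G^α)^{1/(1+α)} ·
G^{-α/(1+α)}; the second factor yields ∑ 1/G. The order of guessing plays no role. -/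
theorem le_guess_moment_of_pos (hG : Set.BijOn G Set.univ (Set.Icc 1 N)) (hp : ∀ s, 0 < p s)
    (hα : 0 < α) :
    (∑ s, p s ^ (1 / (1 + α))) ^ (1 + α) ≤ (∑ s, p s * (G s : ℝ) ^ α) * (harmonic N : ℝ) ^ α := by
  have h1 : 0 < 1 + α := by linarith
  have hGs : ∀ s, (0 : ℝ) < G s := fun s => by exact_mod_cast (hG.mapsTo (Set.mem_univ s)).1
  have hpq : (1 + α).HolderConjugate ((1 + α) / α) := by
    rw [Real.holderConjugate_iff]
    refine ⟨by linarith, ?_⟩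
    field_simp
  have h := Real.inner_le_Lp_mul_Lq_of_nonneg Finset.univ hpq
    (f := fun s => (p s * (G s : ℝ) ^ α) ^ (1 / (1 + α)))
    (g := fun s => ((G s : ℝ)⁻¹) ^ (α / (1 + α)))
    (fun s _ => by have := hp s; positivity) (fun s _ => by positivity)
  have e1 : ∀ s, (p s * (G s : ℝ) ^ α) ^ (1 / (1 + α)) * ((G s : ℝ)⁻¹) ^ (α / (1 + α))
      = p s ^ (1 / (1 + α)) := fun s => by
    have := hGs s
    rw [Real.mul_rpow (hp s).le (by positivity), ← Real.rpow_mul this.le,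
      Real.inv_rpow this.le, mul_assoc, mul_one_div, mul_inv_cancel₀ (by positivity), mul_one]
  have e2 : ∀ s, ((p s * (G s : ℝ) ^ α) ^ (1 / (1 + α))) ^ (1 + α) = p s * (G s : ℝ) ^ α :=
    fun s => by
      have := hGs s
      have := hp s
      rw [← Real.rpow_mul (by positivity), one_div_mul_cancel h1.ne', Real.rpow_one]
  have e3 : ∀ s, (((G s : ℝ)⁻¹) ^ (α / (1 + α))) ^ ((1 + α) / α) = (G s : ℝ)⁻¹ := fun s => by
    have := hGs s
    rw [← Real.rpow_mul (by positivity)]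
    have : α / (1 + α) * ((1 + α) / α) = 1 := by field_simp
    rw [this, Real.rpow_one]
  simp only [e1, e2, e3, sum_inv_eq_harmonic hG] at h
  have hE : 0 ≤ ∑ s, p s * (G s : ℝ) ^ α := Finset.sum_nonneg fun s _ => by
    have := hp s; positivity
  have hH : (0 : ℝ) ≤ harmonic N := by
    rw [← sum_inv_eq_harmonic hG]; exact Finset.sum_nonneg fun s _ => by positivity
  have h' := Real.rpow_le_rpow (Finset.sum_nonneg fun s _ =>
    (Real.rpow_pos_of_pos (hp s) _).le) h h1.le
  refine h'.trans_eq ?_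
  rw [Real.mul_rpow (by positivity) (by positivity), ← Real.rpow_mul hE, ← Real.rpow_mul hH,
    one_div_mul_cancel h1.ne', Real.rpow_one]
  congr 2
  field_simp

/-- Hölder's inequality for p · G^α with exponents 1/(1 + α) and 1/(-α); again the second factor
yields ∑ 1/G. -/
theorem guess_moment_le_of_neg (hG : Set.BijOn G Set.univ (Set.Icc 1 N)) (hp : ∀ s, 0 < p s)
    (hα1 : -1 < α) (hα : α < 0) :
    ∑ s, p s * (G s : ℝ) ^ α
      ≤ (∑ s, p s ^ (1 / (1 + α))) ^ (1 + α) * (harmonic N : ℝ) ^ (-α) := by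
  have h1 : 0 < 1 + α := by linarith
  have hα' : 0 < -α := by linarith
  have hGs : ∀ s, (0 : ℝ) < G s := fun s => by exact_mod_cast (hG.mapsTo (Set.mem_univ s)).1
  have hpq : (1 / (1 + α)).HolderConjugate (1 / (-α)) := by
    rw [Real.holderConjugate_iff]
    refine ⟨by rw [lt_div_iff₀ h1]; linarith, ?_⟩
    simp
  have h := Real.inner_le_Lp_mul_Lq_of_nonneg Finset.univ hpq
    (f := p) (g := fun s => (G s : ℝ) ^ α)
    (fun s _ => (hp s).le) (fun s _ => by positivity)
  have e3 : ∀ s, ((G s : ℝ) ^ α) ^ (1 / (-α)) = (G s : ℝ)⁻¹ := fun s => by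
    have := hGs s
    rw [← Real.rpow_mul (by positivity)]
    have : α * (1 / -α) = -1 := by field_simp [hα.ne]
    rw [this, Real.rpow_neg_one]
  simpa only [e3, sum_inv_eq_harmonic hG, one_div_one_div] using h

/-- The moments of the guessing number are given, up to a power of the harmonic sum, by the Rényi
sums. -/
theorem abs_log_guess_moment_sub_le [Nonempty S] (hG : Set.BijOn G Set.univ (Set.Icc 1 N))
    (hp : ∀ s, 0 < p s) (hanti : ∀ s t, G s ≤ G t → p t ≤ p s) (hα : -1 < α) :
    |Real.log (∑ s, p s * (G s : ℝ) ^ α) - (1 + α) * Real.log (∑ s, p s ^ (1 / (1 + α)))|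
      ≤ |α| * Real.log (harmonic N) := by
  have h1 : 0 < 1 + α := by linarith
  have hGs : ∀ s, (0 : ℝ) < G s := fun s => by exact_mod_cast (hG.mapsTo (Set.mem_univ s)).1
  have hT0 : 0 < ∑ s, p s ^ (1 / (1 + α)) :=
    Finset.sum_pos (fun s _ => Real.rpow_pos_of_pos (hp s) _) Finset.univ_nonempty
  have hE0 : 0 < ∑ s, p s * (G s : ℝ) ^ α :=
    Finset.sum_pos (fun s _ => mul_pos (hp s) (Real.rpow_pos_of_pos (hGs s) _))
      Finset.univ_nonempty
  have hN : N ≠ 0 := by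
    rintro rfl
    obtain ⟨s⟩ := ‹Nonempty S›
    have := hG.mapsTo (Set.mem_univ s)
    simp at this
  have hH1 : (1 : ℝ) ≤ harmonic N := by
    have : (1 : ℚ) ≤ harmonic N := by
      rw [harmonic_eq_sum_Icc]
      have := Finset.single_le_sum (f := fun i : ℕ => ((i : ℚ))⁻¹) (s := Finset.Icc 1 N)
        (fun i _ => by positivity) (Finset.mem_Icc.2 ⟨le_rfl, Nat.one_le_iff_ne_zero.2 hN⟩)
      simpa using this
    exact_mod_cast this
  have hH0 : (0 : ℝ) < harmonic N := by linarith
  have hlog := Real.log_nonneg hH1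
  rw [← Real.log_rpow hT0]
  rcases lt_or_ge α 0 with hneg | hpos
  · have a1 := Real.log_le_log (by positivity) (le_guess_moment_of_neg hG hp hanti hα hneg)
    have a2 := Real.log_le_log hE0 (guess_moment_le_of_neg hG hp hα hneg)
    rw [Real.log_mul (by positivity) (by positivity), Real.log_rpow hH0] at a2
    rw [abs_of_neg hneg, abs_le]
    constructor <;> nlinarith
  · have a1 := Real.log_le_log hE0 (guess_moment_le_of_nonneg hG hp hanti hpos)
    rcases hpos.eq_or_lt with rfl | hpos'
    · simp
    have a2 := Real.log_le_log (by positivity) (le_guess_moment_of_pos hG hp hpos')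
    rw [Real.log_mul (by positivity) (by positivity), Real.log_rpow hH0] at a2
    rw [abs_of_nonneg hpos, abs_le]
    constructor <;> nlinarith

end moments

/-! ### Exponential rates of the products and of the symmetric polynomials -/

/-- The integrand decreases, so n J lies between the right and left Riemann sums. These differ by
the drop of the integrand, which is at most β since 1 + r ≤ e^β (1 + r e^{-β}). -/
theorem sum_log_geom_bounds {β r : ℝ} (hβ : 0 < β) (hr : 0 ≤ r) {n : ℕ} (hn : 0 < n) :
    n * J r β - β ≤ ∑ i ∈ Finset.range n, Real.log (1 + r * base β n ^ (i + 1)) ∧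
      ∑ i ∈ Finset.range n, Real.log (1 + r * base β n ^ (i + 1)) ≤ n * J r β := by
  have hn' : (0 : ℝ) < n := by exact_mod_cast hn
  set f : ℝ → ℝ := fun x => Real.log (1 + r * Real.exp (-β * (x / n))) with hf
  have hanti : Antitone f := fun x y hxy => by
    refine Real.log_le_log (by positivity) ?_
    gcongr 1 + r * Real.exp ?_
    have : x / n ≤ y / n := by gcongr
    nlinarith
  have hint : ∫ x in (0 : ℝ)..(0 + n : ℝ), f x = n * J r β := by
    rw [hf, intervalIntegral.integral_comp_div
      (fun x => Real.log (1 + r * Real.exp (-β * x))) hn'.ne']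
    simp [J, hn'.ne']
  have hfi : ∀ i : ℕ, Real.log (1 + r * base β n ^ i) = f (0 + (i : ℕ)) := fun i => by
    rw [hf, base, ← Real.exp_nat_mul]
    simp only
    congr 4
    ring
  have h1 := AntitoneOn.sum_le_integral (x₀ := 0) (a := n) (f := f) (hanti.antitoneOn _)
  have h2 := AntitoneOn.integral_le_sum (x₀ := 0) (a := n) (f := f) (hanti.antitoneOn _)
  rw [hint] at h1 h2
  simp only [hfi]
  refine ⟨?_, h1⟩
  have h3 := Finset.sum_range_succ (fun i : ℕ => f (0 + (i : ℕ))) n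
  rw [Finset.sum_range_succ'] at h3
  have h4 : f (0 + (0 : ℕ)) - f (0 + (n : ℕ)) ≤ β := by
    have e : f (0 + (0 : ℕ)) ≤ Real.log (Real.exp β * (1 + r * Real.exp (-β))) := by
      simp only [hf]
      refine Real.log_le_log (by positivity) ?_
      have h5 : Real.exp β * Real.exp (-β) = 1 := by rw [← Real.exp_add]; simp
      have h6 : 1 ≤ Real.exp β := Real.one_le_exp hβ.le
      simp only [Nat.cast_zero, add_zero, zero_div, mul_zero, Real.exp_zero, mul_one]
      linear_combination h6 + r * h5.symm
    rw [Real.log_mul (by positivity) (by positivity), Real.log_exp] at e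
    have e' : f (0 + (n : ℕ)) = Real.log (1 + r * Real.exp (-β)) := by
      simp only [hf, zero_add]
      rw [div_self hn'.ne', mul_one]
    linarith
  linarith

theorem log_partitionFun_bounds {β : ℝ} (hβ : 0 < β) {n : ℕ} (hn : 0 < n) :
    n * J 1 β - β ≤ Real.log (partitionFun β n) ∧
      Real.log (partitionFun β n) ≤ n * J 1 β := by
  have h := sum_log_geom_bounds hβ zero_le_one hn
  simp only [one_mul] at h
  rwa [partitionFun, Real.log_prod fun i _ => by have := base_pos β n; positivity]

/-- The limiting saddle point meets the hypothesis of `prod_one_add_geom_le` exactly at every finite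
n, so no approximation error arises here. -/
theorem saddle_base_eq {β : ℝ} (hβ : 0 < β) {n w : ℕ} (hw : w < n) :
    saddle (w / n) β * (base β n ^ w - base β n ^ n) = 1 - base β n ^ w := by
  have hn : (0 : ℝ) < n := by exact_mod_cast (Nat.zero_le w).trans_lt hw
  have h1 : (w / n : ℝ) < 1 := by rw [div_lt_one hn]; exact_mod_cast hw
  have hD := saddle_denom_pos hβ h1
  have e1 : base β n ^ w = Real.exp (-(β * (w / n))) := by
    rw [base, ← Real.exp_nat_mul]; congr 1; ring
  have e2 : base β n ^ n = Real.exp (-(β * (w / n))) * Real.exp (β * (w / n - 1)) := by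
    rw [base, ← Real.exp_nat_mul, ← Real.exp_add]; congr 1; field_simp; ring
  have e3 : Real.exp (-(β * (w / n : ℝ))) * Real.exp (β * (w / n)) = 1 := by
    rw [← Real.exp_add]; simp
  rw [saddle, e1, e2]
  rw [div_mul_eq_mul_div, div_eq_iff hD.ne']
  linear_combination (1 - Real.exp (β * (w / n - 1))) * e3

theorem log_geomEsymm_bounds {β : ℝ} (hβ : 0 < β) {n w : ℕ} (hn : 0 < n) (hw : w ≤ n) :
    n * growth (w / n) β - β - Real.log (n + 1) ≤ Real.log (geomEsymm (base β n) n w) ∧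
      Real.log (geomEsymm (base β n) n w) ≤ n * growth (w / n) β := by
  have hn' : (0 : ℝ) < n := by exact_mod_cast hn
  have hlog : 0 ≤ Real.log ((n : ℝ) + 1) := Real.log_nonneg (by linarith)
  rcases Nat.eq_zero_or_pos w with rfl | h0
  · simp only [geomEsymm_zero_right, Nat.cast_zero, zero_div, growth_zero, Real.log_one]
    constructor <;> linarith
  have hb := base_pos β n
  have hb1 : base β n < 1 := Real.exp_lt_one_iff.2 (div_neg_of_neg_of_pos (by linarith) hn')
  -- At w = n the saddle point is infinite, but e_n is the single monomial x^{n(n+1)/2}.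
  rcases hw.eq_or_lt with rfl | hlt
  · have e : Real.log (geomEsymm (base β w) w w) = -β * (w + 1) / 2 := by
      rw [geomEsymm_self, Real.log_prod fun i _ => by positivity]
      simp only [Real.log_pow, base, Real.log_exp]
      rw [← Finset.sum_mul]
      have : ∀ m : ℕ, ∑ i ∈ Finset.range m, ((i + 1 : ℕ) : ℝ) = m * (m + 1) / 2 := fun m => by
        induction m with
        | zero => simp
        | succ m ih => rw [Finset.sum_range_succ, ih]; push_cast; ring
      rw [this]
      field_simp
    rw [e, div_self hn'.ne', growth_one]
    constructor <;> nlinarith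
  have hw' : (0 : ℝ) < w := by exact_mod_cast h0
  have ht0 : (0 : ℝ) < w / n := by positivity
  have ht1 : (w / n : ℝ) < 1 := by rw [div_lt_one hn']; exact_mod_cast hlt
  have hr := saddle_pos hβ ht0 ht1
  have he := geomEsymm_pos hb hw
  have hprod : Real.log (∏ i ∈ Finset.range n, (1 + saddle (w / n) β * base β n ^ (i + 1)))
      = ∑ i ∈ Finset.range n, Real.log (1 + saddle (w / n) β * base β n ^ (i + 1)) :=
    Real.log_prod fun i _ => by positivity
  have hs := sum_log_geom_bounds hβ hr.le hn
  rw [← hprod] at hs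
  have h1 := Real.log_le_log (Finset.prod_pos fun i _ => by positivity)
    (prod_one_add_geom_le hb hb1 hlt (saddle_base_eq hβ hlt))
  have h2 := Real.log_le_log (by positivity) (geomEsymm_mul_pow_le hb.le hr.le hw)
  rw [Real.log_mul (by positivity) (by positivity), Real.log_mul he.ne' (by positivity),
    Real.log_pow] at h1
  rw [Real.log_mul he.ne' (by positivity), Real.log_pow] at h2
  have hg : n * growth (w / n) β
      = n * J (saddle (w / n) β) β - w * Real.log (saddle (w / n) β) := by
    rw [growth_of_lt ht1]
    field_simp
  rw [hg]
  constructor <;> linarith [hs.1, hs.2]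

/-! ### The variational formula -/

/-- The exponent of the words of relative weight `t` in the moment of order `α`. -/
noncomputable def exponent (β α t : ℝ) : ℝ := α * Real.binEntropy t + growth t β

noncomputable def maxExponent (β α : ℝ) : ℝ := sSup (exponent β α '' Set.Icc 0 1)

theorem continuousOn_exponent {β : ℝ} (hβ : 0 < β) (α : ℝ) :
    ContinuousOn (exponent β α) (Set.Icc 0 1) :=
  (Real.binEntropy_continuous.const_mul α |>.continuousOn).add (continuousOn_growth hβ)

theorem isGreatest_maxExponent {β : ℝ} (hβ : 0 < β) (α : ℝ) :
    IsGreatest (exponent β α '' Set.Icc 0 1) (maxExponent β α) :=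
  (isCompact_Icc.image_of_continuousOn (continuousOn_exponent hβ α)).isGreatest_sSup
    ⟨_, Set.mem_image_of_mem _ (Set.left_mem_Icc.2 zero_le_one)⟩

theorem exponent_le_maxExponent {β : ℝ} (hβ : 0 < β) (α : ℝ) {t : ℝ} (ht : t ∈ Set.Icc (0 : ℝ) 1) :
    exponent β α t ≤ maxExponent β α :=
  (isGreatest_maxExponent hβ α).2 (Set.mem_image_of_mem _ ht)

theorem exists_exponent_eq {β : ℝ} (hβ : 0 < β) (α : ℝ) :
    ∃ t ∈ Set.Icc (0 : ℝ) 1, exponent β α t = maxExponent β α :=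
  (isGreatest_maxExponent hβ α).1

theorem typicalWeight_mem {β : ℝ} (hβ : 0 < β) : typicalWeight β ∈ Set.Icc (0 : ℝ) 1 :=
  ⟨(typicalWeight_pos hβ).le, (typicalWeight_lt_one hβ).le⟩

theorem growth_le_J_one {t β : ℝ} (hβ : 0 < β) (ht : t ∈ Set.Icc (0 : ℝ) 1) :
    growth t β ≤ J 1 β := by
  by_cases h : t = typicalWeight β
  · rw [h, growth_typicalWeight hβ]
  · exact (growth_lt_J_one hβ ht.1 ht.2 h).le

theorem maxExponent_zero {β : ℝ} (hβ : 0 < β) : maxExponent β 0 = J 1 β := by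
  refine le_antisymm ?_ ?_
  · obtain ⟨t, ht, h⟩ := exists_exponent_eq hβ 0
    rw [← h, exponent, zero_mul, zero_add]
    exact growth_le_J_one hβ ht
  · have := exponent_le_maxExponent hβ 0 (typicalWeight_mem hβ)
    rwa [exponent, zero_mul, zero_add, growth_typicalWeight hβ] at this

theorem maxExponent_neg_one {β : ℝ} (hβ : 0 < β) : maxExponent β (-1) = 0 := by
  refine le_antisymm ?_ ?_
  · obtain ⟨t, ht, h⟩ := exists_exponent_eq hβ (-1)
    rw [← h, exponent]
    linarith [growth_le_binEntropy hβ ht.1 ht.2]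
  · have := exponent_le_maxExponent hβ (-1) (t := 0) (by simp)
    simpa [exponent, growth_zero] using this

/-- For each t the exponent is affine in α with slope h(t) in [0, log 2]. -/
theorem abs_maxExponent_sub_le {β : ℝ} (hβ : 0 < β) (α α' : ℝ) :
    |maxExponent β α - maxExponent β α'| ≤ |α - α'| * Real.log 2 := by
  have key : ∀ a b : ℝ, maxExponent β a - maxExponent β b ≤ |a - b| * Real.log 2 := fun a b => by
    obtain ⟨t, ht, h⟩ := exists_exponent_eq hβ a
    have h2 := exponent_le_maxExponent hβ b ht
    have h3 : (a - b) * Real.binEntropy t ≤ |a - b| * Real.log 2 :=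
      mul_le_mul (le_abs_self _) Real.binEntropy_le_log_two
        (Real.binEntropy_nonneg ht.1 ht.2) (abs_nonneg _)
    rw [← h]
    unfold exponent at h2 ⊢
    linarith
  rw [abs_sub_le_iff]
  exact ⟨key α α', abs_sub_comm α α' ▸ key α' α⟩

theorem tendsto_maxExponent {β : ℝ} (hβ : 0 < β) (α : ℝ) :
    Tendsto (maxExponent β) (𝓝 α) (𝓝 (maxExponent β α)) := by
  rw [tendsto_iff_norm_sub_tendsto_zero]
  refine squeeze_zero (fun _ => norm_nonneg _) (fun a => abs_maxExponent_sub_le hβ a α) ?_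
  have : Continuous fun a : ℝ => |a - α| * Real.log 2 := by fun_prop
  simpa using this.tendsto α

/-- The derivative of the maximum at `0` is the entropy at the unique maximizer. -/
theorem tendsto_maxExponent_slope {β : ℝ} (hβ : 0 < β) :
    Tendsto (fun α => (maxExponent β α - J 1 β) / α) (𝓝[≠] 0)
      (𝓝 (Real.binEntropy (typicalWeight β))) := by
  set τ := typicalWeight β with hτ
  rw [Metric.tendsto_nhds]
  intro ε hε
  -- On this compact set, which misses τ, growth stays below its maximum by some η.
  set A := Set.Icc (0 : ℝ) 1 ∩ {t | ε ≤ |Real.binEntropy t - Real.binEntropy τ|} with hA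
  have hAc : IsCompact A := isCompact_Icc.inter_right
    (isClosed_le continuous_const (by fun_prop))
  obtain ⟨η, hη, hAη⟩ : ∃ η > 0, ∀ t ∈ A, growth t β ≤ J 1 β - η := by
    rcases A.eq_empty_or_nonempty with he | hne
    · exact ⟨1, one_pos, by simp [he]⟩
    obtain ⟨t, ht, hmax⟩ := hAc.exists_isMaxOn hne
      ((continuousOn_growth hβ).mono Set.inter_subset_left)
    refine ⟨J 1 β - growth t β, sub_pos.2 (growth_lt_J_one hβ ht.1.1 ht.1.2 ?_), fun s hs => ?_⟩
    · rintro rfl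
      have : ε ≤ |Real.binEntropy τ - Real.binEntropy τ| := ht.2
      simp at this
      linarith
    · have := hmax hs
      simp only [Set.mem_ofPred_eq] at this
      linarith
  have hl2 : 0 < Real.log 2 := Real.log_pos one_lt_two
  -- For such α the entropy term can gain at most |α| log 2 < η over its value at τ, so no maximizer
  -- lies in A.
  have hball : Metric.ball (0 : ℝ) (η / Real.log 2) ∈ 𝓝 (0 : ℝ) :=
    Metric.ball_mem_nhds _ (by positivity)
  filter_upwards [self_mem_nhdsWithin, mem_nhdsWithin_of_mem_nhds hball] with α hα0 hα
  have hα0 : α ≠ 0 := hα0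
  rw [mem_ball_zero_iff, Real.norm_eq_abs, lt_div_iff₀ hl2] at hα
  obtain ⟨t, ht, hmax⟩ := exists_exponent_eq hβ α
  have hge := exponent_le_maxExponent hβ α (typicalWeight_mem hβ)
  rw [← hmax] at hge ⊢
  unfold exponent at hge ⊢
  rw [growth_typicalWeight hβ, ← hτ] at hge
  have hgt := growth_le_J_one hβ ht
  have hclose : |Real.binEntropy t - Real.binEntropy τ| < ε := by
    by_contra! hcon
    have h1 := hAη t ⟨ht, hcon⟩
    have h2 : α * (Real.binEntropy t - Real.binEntropy τ) ≤ |α| * Real.log 2 := by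
      refine (le_abs_self _).trans ?_
      rw [abs_mul]
      refine mul_le_mul_of_nonneg_left ?_ (abs_nonneg _)
      have a1 := Real.binEntropy_nonneg ht.1 ht.2
      have a2 := Real.binEntropy_nonneg (typicalWeight_mem hβ).1 (typicalWeight_mem hβ).2
      have a3 := Real.binEntropy_le_log_two (p := t)
      have a4 := Real.binEntropy_le_log_two (p := τ)
      rw [abs_le]
      constructor <;> linarith
    nlinarith
  refine lt_of_le_of_lt ?_ hclose
  -- Optimality of t and growth ≤ J(1; β) squeeze u between α h(τ) and α h(t), for either sign of α.
  set u := α * Real.binEntropy t + growth t β - J 1 β with hu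
  have h1 : α * Real.binEntropy τ ≤ u := by linarith
  have h2 : u ≤ α * Real.binEntropy t := by linarith
  have h3 : |u - α * Real.binEntropy τ| ≤ |α * Real.binEntropy t - α * Real.binEntropy τ| := by
    rw [abs_of_nonneg (by linarith), abs_of_nonneg (by linarith)]
    linarith
  rw [← mul_sub, abs_mul] at h3
  have hαp := abs_pos.2 hα0
  rw [Real.dist_eq]
  have h4 : u / α - Real.binEntropy τ = (u - α * Real.binEntropy τ) / α := by field_simp
  rw [h4, abs_div, div_le_iff₀ hαp]
  linarith

/-! ### Rényi entropy rates -/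

/-- The Rényi sum of the noise effect. -/
noncomputable def renyiSum (β : ℝ) (n : ℕ) (inp : PMF (Word n)) (ρ : ℝ) : ℝ :=
  ∑ z, (hardNoise β n inp z).toReal ^ ρ

theorem tendsto_log_succ_div :
    Tendsto (fun n : ℕ => Real.log ((n : ℝ) + 1) / n) atTop (𝓝 0) := by
  have h : Tendsto (fun x : ℝ => Real.log x / (x + (-1))) atTop (𝓝 0) := by
    simpa using Real.tendsto_pow_log_div_mul_add_atTop 1 (-1) 1 one_ne_zero
  have h2 : Tendsto (fun n : ℕ => (n : ℝ) + 1) atTop atTop :=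
    tendsto_natCast_atTop_atTop.atTop_add tendsto_const_nhds
  refine (h.comp h2).congr fun n => ?_
  simp

/-- The logarithm of the contribution of weight `w` to the Rényi sum. -/
theorem abs_log_renyi_term_sub_le {β : ℝ} (hβ : 0 < β) {ρ : ℝ} (hρ : 0 < ρ) {n w : ℕ} (hn : 0 < n)
    (hw : w ≤ n) :
    |Real.log ((n.choose w : ℝ) * (geomEsymm (base β n) n w / (n.choose w * partitionFun β n)) ^ ρ)
      - n * (ρ * (exponent β (1 / ρ - 1) (w / n) - J 1 β))|
      ≤ ρ * (2 * β + (1 + |1 / ρ - 1|) * Real.log (n + 1)) := by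
  have hc : (0 : ℝ) < n.choose w := by exact_mod_cast Nat.choose_pos hw
  have hZ := partitionFun_pos β n
  have he := geomEsymm_pos (base_pos β n) hw
  have hlog : 0 ≤ Real.log ((n : ℝ) + 1) := Real.log_nonneg (by linarith [n.cast_nonneg (α := ℝ)])
  rw [Real.log_mul hc.ne' (by positivity), Real.log_rpow (by positivity),
    Real.log_div he.ne' (by positivity), Real.log_mul hc.ne' hZ.ne']
  obtain ⟨e1, e2⟩ := log_geomEsymm_bounds hβ hn hw
  obtain ⟨z1, z2⟩ := log_partitionFun_bounds hβ hn
  have c1 := le_log_choose hn hw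
  have c2 := log_choose_le hn hw
  set C := Real.log (n.choose w : ℝ)
  set E := Real.log (geomEsymm (base β n) n w)
  set Z := Real.log (partitionFun β n)
  set L := Real.log ((n : ℝ) + 1)
  have heq : C + ρ * (E - (C + Z)) - n * (ρ * (exponent β (1 / ρ - 1) (w / n) - J 1 β))
      = ρ * ((1 / ρ - 1) * (C - n * Real.binEntropy (w / n)) + (E - n * growth (w / n) β)
        - (Z - n * J 1 β)) := by
    unfold exponent
    field_simp
    ring
  rw [heq, abs_mul, abs_of_pos hρ]
  refine mul_le_mul_of_nonneg_left ?_ hρ.le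
  have a1 : |(1 / ρ - 1) * (C - n * Real.binEntropy (w / n))| ≤ |1 / ρ - 1| * L := by
    rw [abs_mul]
    refine mul_le_mul_of_nonneg_left ?_ (abs_nonneg _)
    rw [abs_le]; constructor <;> linarith
  have a2 : |E - n * growth (w / n) β| ≤ β + L := by
    rw [abs_le]; constructor <;> linarith
  have a3 : |Z - n * J 1 β| ≤ β := by
    rw [abs_le]; constructor <;> linarith
  have b1 := abs_sub ((1 / ρ - 1) * (C - n * Real.binEntropy (w / n)) + (E - n * growth (w / n) β))
    (Z - n * J 1 β)
  have b2 := abs_add_le ((1 / ρ - 1) * (C - n * Real.binEntropy (w / n)))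
    (E - n * growth (w / n) β)
  linarith

theorem renyiSum_pos (β : ℝ) (n : ℕ) (inp : PMF (Word n)) (ρ : ℝ) : 0 < renyiSum β n inp ρ :=
  Finset.sum_pos (fun z _ => Real.rpow_pos_of_pos (hardNoise_toReal_pos β n inp z) _)
    Finset.univ_nonempty

/-- Laplace's method for a sum of n + 1 terms. From below, keep only the weight ⌊t n⌋ with t a
maximizer and use continuity of the exponent; from above, bound every term by the maximum. -/
theorem tendsto_log_renyiSum {β : ℝ} (hβ : 0 < β) (inp : ∀ n, PMF (Word n)) {ρ : ℝ} (hρ : 0 < ρ) :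
    Tendsto (fun n : ℕ => Real.log (renyiSum β n (inp n) ρ) / n) atTop
      (𝓝 (ρ * (maxExponent β (1 / ρ - 1) - J 1 β))) := by
  set α := 1 / ρ - 1 with hα
  set K : ℕ → ℝ := fun n => ρ * (2 * β + (1 + |α|) * Real.log (n + 1)) with hK
  have hKlim : Tendsto (fun n : ℕ => K n / n) atTop (𝓝 0) := by
    have h : Tendsto (fun n : ℕ => ρ * (2 * β * (1 / (n : ℝ))
        + (1 + |α|) * (Real.log ((n : ℝ) + 1) / n))) atTop (𝓝 (ρ * (2 * β * 0 + (1 + |α|) * 0))) :=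
      ((tendsto_one_div_atTop_nhds_zero_nat.const_mul _).add
        (tendsto_log_succ_div.const_mul _)).const_mul _
    rw [show ρ * (2 * β * 0 + (1 + |α|) * 0) = 0 by ring] at h
    refine h.congr fun n => ?_
    rw [hK]
    ring
  obtain ⟨t, ht, hmax⟩ := exists_exponent_eq hβ α
  have hfloor : Tendsto (fun n : ℕ => (⌊t * n⌋₊ : ℝ) / n) atTop (𝓝 t) :=
    (tendsto_nat_floor_mul_div_atTop ht.1).comp tendsto_natCast_atTop_atTop
  have hfl : ∀ n : ℕ, ⌊t * n⌋₊ ≤ n := fun n => by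
    refine Nat.floor_le_of_le ?_
    have := n.cast_nonneg (α := ℝ)
    nlinarith [ht.2]
  have hmem : ∀ n w : ℕ, w ≤ n → (w / n : ℝ) ∈ Set.Icc (0 : ℝ) 1 := fun n w h =>
    ⟨by positivity, div_le_one_of_le₀ (by exact_mod_cast h) (by positivity)⟩
  have hexp : Tendsto (fun n : ℕ => exponent β α ((⌊t * n⌋₊ : ℝ) / n)) atTop
      (𝓝 (maxExponent β α)) := by
    rw [← hmax]
    refine Tendsto.comp (continuousOn_exponent hβ α t ht) ?_
    exact tendsto_nhdsWithin_iff.2 ⟨hfloor, Eventually.of_forall fun n => hmem n _ (hfl n)⟩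
  have hlow : Tendsto (fun n : ℕ => ρ * (exponent β α ((⌊t * n⌋₊ : ℝ) / n) - J 1 β) - K n / n)
      atTop (𝓝 (ρ * (maxExponent β α - J 1 β))) := by
    simpa using ((hexp.sub_const (J 1 β)).const_mul ρ).sub hKlim
  have hupp : Tendsto (fun n : ℕ => ρ * (maxExponent β α - J 1 β)
      + (K n / n + Real.log ((n : ℝ) + 1) / n)) atTop (𝓝 (ρ * (maxExponent β α - J 1 β))) := by
    simpa using (hKlim.add tendsto_log_succ_div).const_add (ρ * (maxExponent β α - J 1 β))
  have hterm : ∀ n w : ℕ, w ≤ n → 0 < (n.choose w : ℝ)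
      * (geomEsymm (base β n) n w / (n.choose w * partitionFun β n)) ^ ρ := fun n w hw => by
    have h1 := geomEsymm_pos (base_pos β n) hw
    have h2 := partitionFun_pos β n
    have h3 : (0 : ℝ) < n.choose w := by exact_mod_cast Nat.choose_pos hw
    positivity
  refine tendsto_of_tendsto_of_tendsto_of_le_of_le' hlow hupp ?_ ?_
  · filter_upwards [eventually_gt_atTop 0] with n hn
    have hn' : (0 : ℝ) < n := by exact_mod_cast hn
    have h := (abs_le.1 (abs_log_renyi_term_sub_le hβ hρ hn (hfl n))).1
    have h2 := Real.log_le_log (hterm n _ (hfl n)) (Finset.single_le_sum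
      (f := fun w => (n.choose w : ℝ)
        * (geomEsymm (base β n) n w / (n.choose w * partitionFun β n)) ^ ρ)
      (fun w hw => (hterm n w (Nat.lt_succ_iff.1 (Finset.mem_range.1 hw))).le)
      (Finset.mem_range.2 (Nat.lt_succ_of_le (hfl n))))
    rw [← sum_hardNoise_rpow β n (inp n), ← renyiSum] at h2
    rw [le_div_iff₀ hn', sub_mul, div_mul_cancel₀ _ hn'.ne']
    simp only [hK]
    linarith
  · filter_upwards [eventually_gt_atTop 0] with n hn
    have hn' : (0 : ℝ) < n := by exact_mod_cast hn
    have hle : renyiSum β n (inp n) ρ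
        ≤ (n + 1) * Real.exp (n * (ρ * (maxExponent β α - J 1 β)) + K n) := by
      rw [renyiSum, sum_hardNoise_rpow]
      refine (Finset.sum_le_card_nsmul _ _
        (Real.exp (n * (ρ * (maxExponent β α - J 1 β)) + K n)) fun w hw => ?_).trans ?_
      · have hw := Nat.lt_succ_iff.1 (Finset.mem_range.1 hw)
        rw [← Real.log_le_iff_le_exp (hterm n w hw)]
        have h := (abs_le.1 (abs_log_renyi_term_sub_le hβ hρ hn hw)).2
        have h2 : n * (ρ * (exponent β α (w / n) - J 1 β))
            ≤ n * (ρ * (maxExponent β α - J 1 β)) := by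
          have := exponent_le_maxExponent hβ α (hmem n w hw)
          gcongr
        simp only [hK]
        linarith
      · simp
    have h2 := Real.log_le_log (renyiSum_pos β n (inp n) ρ) hle
    rw [Real.log_mul (by positivity) (by positivity), Real.log_exp] at h2
    rw [div_le_iff₀ hn', add_mul, add_mul, div_mul_cancel₀ _ hn'.ne', div_mul_cancel₀ _ hn'.ne']
    linarith

/-- The Rényi entropy rate of the noise effect. -/
noncomputable def renyiRate (β ρ : ℝ) : ℝ :=
  if ρ = 1 then Real.binEntropy (typicalWeight β)
  else (maxExponent β (1 / ρ - 1) - J 1 β) / (1 / ρ - 1)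

/-- For ρ = 1/(1 + α) one has 1/ρ - 1 = α. At α = 0, where the rate is defined separately, both
sides vanish. -/
theorem mul_renyiRate {β : ℝ} (hβ : 0 < β) {α : ℝ} (hα : -1 < α) :
    α * renyiRate β (1 / (1 + α)) = maxExponent β α - J 1 β := by
  rcases eq_or_ne α 0 with rfl | h0
  · rw [maxExponent_zero hβ]; simp
  have h1 : 1 / (1 + α) ≠ 1 := fun h => h0 (by
    rw [div_eq_one_iff_eq (by linarith)] at h; linarith)
  rw [renyiRate, if_neg h1, one_div_one_div, add_sub_cancel_left, mul_div_cancel₀ _ h0]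

theorem tendsto_one_div_sub_one :
    Tendsto (fun ρ : ℝ => 1 / ρ - 1) (𝓝[≠] 1) (𝓝[≠] 0) := by
  refine tendsto_nhdsWithin_iff.2 ⟨?_, ?_⟩
  · have h : ContinuousAt (fun ρ : ℝ => 1 / ρ - 1) 1 :=
      (continuousAt_const.div continuousAt_id one_ne_zero).sub continuousAt_const
    have := h.tendsto.mono_left (nhdsWithin_le_nhds (s := {1}ᶜ))
    simpa using this
  · filter_upwards [self_mem_nhdsWithin,
      mem_nhdsWithin_of_mem_nhds (Ioi_mem_nhds (zero_lt_one' ℝ))] with ρ h1 h0 h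
    have h1 : ρ ≠ 1 := h1
    have h0 : 0 < ρ := h0
    have h : 1 / ρ - 1 = 0 := h
    rw [sub_eq_zero, div_eq_one_iff_eq h0.ne'] at h
    exact h1 h.symm

theorem hasRenyiRates_hardNoise {β : ℝ} (hβ : 0 < β) (inp : ∀ n, PMF (Word n)) :
    HasRenyiRates (fun n => hardNoise β n (inp n)) (renyiRate β) (J 1 β) where
  rate ρ hρ hρ1 := by
    have h1 : 1 - ρ ≠ 0 := sub_ne_zero.2 hρ1.symm
    have h := (tendsto_log_renyiSum hβ inp hρ).const_mul (1 / (1 - ρ))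
    rw [show 1 / (1 - ρ) * (ρ * (maxExponent β (1 / ρ - 1) - J 1 β)) = renyiRate β ρ by
      rw [renyiRate, if_neg hρ1]
      have : 1 / ρ - 1 = (1 - ρ) / ρ := by field_simp
      rw [div_eq_mul_inv _ (1 / ρ - 1), this, inv_div]
      field_simp] at h
    refine h.congr fun n => ?_
    rw [renyiEntropy, renyiSum]
    ring
  shannon := by
    rw [renyiRate, if_pos rfl]
    refine ((tendsto_maxExponent_slope hβ).comp tendsto_one_div_sub_one).congr' ?_
    filter_upwards [self_mem_nhdsWithin] with ρ hρ
    rw [renyiRate, if_neg (show ρ ≠ 1 from hρ), Function.comp]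
  min := by
    have hinv : Tendsto (fun ρ : ℝ => 1 / ρ - 1) atTop (𝓝 (-1)) := by
      simpa using (tendsto_inv_atTop_zero (𝕜 := ℝ)).sub_const 1
    have h := (((tendsto_maxExponent hβ (-1)).comp hinv).sub_const (J 1 β)).div hinv (by norm_num)
    -- As ρ → ∞ the order 1/ρ - 1 tends to -1, and the quotient to (0 - J(1; β))/(-1).
    rw [maxExponent_neg_one hβ, zero_sub, neg_div_neg_eq, div_one] at h
    refine h.congr' ?_
    filter_upwards [eventually_gt_atTop 1] with ρ hρ
    rw [renyiRate, if_neg hρ.ne']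
    rfl

/-! ### Limits of the guessing moments -/

theorem log_harmonic_two_pow_le (n : ℕ) :
    Real.log (harmonic (2 ^ n)) ≤ Real.log ((n : ℝ) + 1) := by
  have hpos : (0 : ℝ) < harmonic (2 ^ n) := by
    exact_mod_cast harmonic_pos (by positivity)
  refine Real.log_le_log hpos ((harmonic_le_one_add_log _).trans ?_)
  push_cast
  rw [Real.log_pow]
  have : Real.log 2 ≤ 1 := by linarith [Real.log_two_lt_d9]
  nlinarith [n.cast_nonneg (α := ℝ)]

/-- The moments of the guessing number. -/
noncomputable def guessMoment (β : ℝ) (n : ℕ) (inp : PMF (Word n)) (G : Word n → ℕ) (α : ℝ) : ℝ :=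
  ∑ z, (hardNoise β n inp z).toReal * (G z : ℝ) ^ α

theorem IsHardGuessing.one_le {n : ℕ} {G : Word n → ℕ} (hG : IsHardGuessing n G) (z : Word n) :
    1 ≤ G z := (hG.bijOn.mapsTo (Set.mem_univ z)).1

theorem expect_exp_eq_guessMoment (β : ℝ) {n : ℕ} (hn : 0 < n) (inp : PMF (Word n))
    {G : Word n → ℕ} (hG : IsHardGuessing n G) (α : ℝ) :
    (expect (hardNoise β n inp) fun z => Real.exp (α * n * (1 / (n : ℝ) * Real.log (G z : ℝ))))
      = guessMoment β n inp G α := by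
  have hn' : (n : ℝ) ≠ 0 := by exact_mod_cast hn.ne'
  refine Finset.sum_congr rfl fun z _ => ?_
  have hGz : (0 : ℝ) < G z := by exact_mod_cast hG.one_le z
  rw [Real.rpow_def_of_pos hGz]
  congr 2
  field_simp

theorem tendsto_log_guessMoment {β : ℝ} (hβ : 0 < β) (inp : ∀ n, PMF (Word n))
    {G : ∀ n, Word n → ℕ} (hG : ∀ n, IsHardGuessing n (G n)) {α : ℝ} (hα : -1 < α) :
    Tendsto (fun n : ℕ => Real.log (guessMoment β n (inp n) (G n) α) / n) atTop
      (𝓝 (maxExponent β α - J 1 β)) := by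
  have h1 : 0 < 1 + α := by linarith
  have hR := (tendsto_log_renyiSum hβ inp (ρ := 1 / (1 + α)) (by positivity)).const_mul (1 + α)
  rw [one_div_one_div, add_sub_cancel_left, ← mul_assoc, mul_one_div_cancel h1.ne', one_mul] at hR
  have hdiff : Tendsto (fun n : ℕ => Real.log (guessMoment β n (inp n) (G n) α) / n
      - (1 + α) * (Real.log (renyiSum β n (inp n) (1 / (1 + α))) / n)) atTop (𝓝 0) := by
    refine squeeze_zero_norm (a := fun n : ℕ => |α| * (Real.log ((n : ℝ) + 1) / n))
      (fun n => ?_) (by simpa using tendsto_log_succ_div.const_mul |α|)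
    have h := abs_log_guess_moment_sub_le (hG n).bijOn (hardNoise_toReal_pos β n (inp n))
      (hardNoise_anti_guess hβ.le (inp n) (hG n)) hα
    have h2 := mul_le_mul_of_nonneg_left (log_harmonic_two_pow_le n) (abs_nonneg α)
    have e : Real.log (guessMoment β n (inp n) (G n) α) / n
        - (1 + α) * (Real.log (renyiSum β n (inp n) (1 / (1 + α))) / n)
        = (Real.log (guessMoment β n (inp n) (G n) α)
          - (1 + α) * Real.log (renyiSum β n (inp n) (1 / (1 + α)))) / n := by ring
    rw [e, Real.norm_eq_abs, abs_div, Nat.abs_cast, ← mul_div_assoc]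
    exact div_le_div_of_nonneg_right (h.trans h2) (by positivity)
  simpa using hdiff.add hR

theorem hardNoise_zero_toReal (β : ℝ) (n : ℕ) (inp : PMF (Word n)) :
    (hardNoise β n inp 0).toReal = (partitionFun β n)⁻¹ := by
  rw [hardNoise_toReal_eq]
  simp [geomEsymm_zero_right]

/-- The first guess alone contributes at least Pr(Z = 0). Conversely every probability is at most
Pr(Z = 0), and G^α ≤ 1/G sums to a harmonic number, of order n. -/
theorem guessMoment_bounds_of_le {β : ℝ} (hβ : 0 < β) {n : ℕ} (inp : PMF (Word n))
    {G : Word n → ℕ} (hG : IsHardGuessing n G) {α : ℝ} (hα : α ≤ -1) :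
    (partitionFun β n)⁻¹ ≤ guessMoment β n inp G α ∧
      guessMoment β n inp G α ≤ (partitionFun β n)⁻¹ * (harmonic (2 ^ n) : ℝ) := by
  rw [← hardNoise_zero_toReal β n inp]
  have hp := hardNoise_toReal_pos β n inp
  constructor
  · obtain ⟨z, -, hz⟩ := hG.bijOn.surjOn (show 1 ∈ Set.Icc 1 (2 ^ n) from
      ⟨le_rfl, Nat.one_le_two_pow⟩)
    refine (hardNoise_anti_guess hβ.le inp hG z 0 (hz ▸ hG.one_le 0)).trans ?_
    refine le_of_eq_of_le ?_ (Finset.single_le_sum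
      (f := fun z => (hardNoise β n inp z).toReal * (G z : ℝ) ^ α)
      (fun y _ => mul_nonneg (hp y).le (by positivity)) (Finset.mem_univ z))
    simp [hz]
  · rw [← sum_inv_eq_harmonic hG.bijOn, Finset.mul_sum]
    refine Finset.sum_le_sum fun z _ => ?_
    have hGz : (1 : ℝ) ≤ G z := by exact_mod_cast hG.one_le z
    refine mul_le_mul (hardNoise_anti hβ.le n inp (by simp)) ?_ (by positivity) (hp 0).le
    rw [← Real.rpow_neg_one]
    exact Real.rpow_le_rpow_of_exponent_le hGz hα

theorem tendsto_log_guessMoment_of_le {β : ℝ} (hβ : 0 < β) (inp : ∀ n, PMF (Word n))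
    {G : ∀ n, Word n → ℕ} (hG : ∀ n, IsHardGuessing n (G n)) {α : ℝ} (hα : α ≤ -1) :
    Tendsto (fun n : ℕ => Real.log (guessMoment β n (inp n) (G n) α) / n) atTop
      (𝓝 (-J 1 β)) := by
  have hupp : Tendsto (fun n : ℕ => -J 1 β + (β * (1 / (n : ℝ)) + Real.log ((n : ℝ) + 1) / n))
      atTop (𝓝 (-J 1 β)) := by
    simpa using ((tendsto_one_div_atTop_nhds_zero_nat.const_mul β).add
      tendsto_log_succ_div).const_add (-J 1 β)
  refine tendsto_of_tendsto_of_tendsto_of_le_of_le' tendsto_const_nhds hupp ?_ ?_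
  · filter_upwards [eventually_gt_atTop 0] with n hn
    have hn' : (0 : ℝ) < n := by exact_mod_cast hn
    have hZ := partitionFun_pos β n
    have h := Real.log_le_log (by positivity) (guessMoment_bounds_of_le hβ (inp n) (hG n) hα).1
    rw [Real.log_inv] at h
    rw [le_div_iff₀ hn']
    linarith [(log_partitionFun_bounds hβ hn).2]
  · filter_upwards [eventually_gt_atTop 0] with n hn
    have hn' : (0 : ℝ) < n := by exact_mod_cast hn
    have hZ := partitionFun_pos β n
    have hb := guessMoment_bounds_of_le hβ (inp n) (hG n) hα
    have hH : (0 : ℝ) < harmonic (2 ^ n) := by exact_mod_cast harmonic_pos (by positivity)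
    have h := Real.log_le_log ((inv_pos.2 hZ).trans_le hb.1) hb.2
    rw [Real.log_mul (by positivity) hH.ne', Real.log_inv] at h
    rw [div_le_iff₀ hn', add_mul, add_mul, div_mul_cancel₀ _ hn'.ne', mul_assoc,
      one_div_mul_cancel hn'.ne']
    linarith [(log_partitionFun_bounds hβ hn).1, log_harmonic_two_pow_le n]

end LRC

/-- The scaled cumulant generating function of hard-decision guesswork in the linear reliability
channel, with its Rényi entropy rates and min-entropy rate. -/
theorem mainTheorem2 (β : ℝ) (hβ : 0 < β)
    (inp : ∀ n : ℕ, PMF (LRC.Word n))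
    (G : ∀ n : ℕ, LRC.Word n → ℕ) (hG : ∀ n : ℕ, LRC.IsHardGuessing n (G n)) :
    ∃ (Λ H : ℝ → ℝ) (Hmin : ℝ),
      LRC.IsSCGF (fun n => LRC.hardNoise β n (inp n))
        (fun n z => 1 / (n : ℝ) * Real.log (G n z : ℝ)) Λ ∧
      LRC.HasRenyiRates (fun n => LRC.hardNoise β n (inp n)) H Hmin ∧
      (∀ α : ℝ, -1 < α → Λ α = α * H (1 / (1 + α))) ∧
      (∀ α : ℝ, α ≤ -1 → Λ α = -Hmin) ∧
      (∀ α : ℝ, -1 < α → ∃ M : ℝ,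
        IsGreatest ((fun t : ℝ => α * Real.binEntropy t + LRC.growth t β) '' Set.Icc 0 1) M ∧
        α * H (1 / (1 + α)) = M - LRC.J 1 β) ∧
      Hmin = LRC.J 1 β := by
  refine ⟨fun α => if -1 < α then LRC.maxExponent β α - LRC.J 1 β else -LRC.J 1 β,
    LRC.renyiRate β, LRC.J 1 β, fun α => ?_, LRC.hasRenyiRates_hardNoise hβ inp,
    fun α hα => ?_, fun α hα => if_neg hα.not_gt, fun α hα =>
      ⟨LRC.maxExponent β α, LRC.isGreatest_maxExponent hβ α, LRC.mul_renyiRate hβ hα⟩, rfl⟩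
  · have h : Tendsto (fun n : ℕ => Real.log (LRC.guessMoment β n (inp n) (G n) α) / n) atTop
        (𝓝 (if -1 < α then LRC.maxExponent β α - LRC.J 1 β else -LRC.J 1 β)) := by
      split_ifs with hα
      · exact LRC.tendsto_log_guessMoment hβ inp hG hα
      · exact LRC.tendsto_log_guessMoment_of_le hβ inp hG (not_lt.1 hα)
    refine h.congr' ?_
    filter_upwards [eventually_gt_atTop 0] with n hn
    rw [LRC.expect_exp_eq_guessMoment β hn (inp n) (hG n) α]
    ring
  · rw [LRC.mul_renyiRate hβ hα]
    exact if_pos hα
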